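/- Finitely generated Coxeter groups are accessible with respect to splittings over finite groups, in the following sense. A graph of groups $\Lambda$ consists of a connected graph (loops and multiple edges allowed) with vertex set $V(\Lambda)$, edge set $E(\Lambda)$ and maps $\iota,\tau:E(\Lambda)\to V(\Lambda)$, of vertex groups $\Lambda(v)$, and of edge groups $\Lambda(e)\le\Lambda(\iota(e))$ with injective homomorphisms $t_e:\Lambda(e)\to\Lambda(\tau(e))$. Its fundamental group $\pi_1(\Lambda)$ is generated by the disjoint union of the vertex groups together with symbols $s_e$ $(e\in E(\Lambda))$, subject to the relations of the vertex groups, $g\,s_e=s_e\,t_e(g)$ for $g\in\Lambda(e)$, and $s_e=1$ for $e$ in a spanning tree. $\Lambda$ is a decomposition of a group $W$ if $\pi_1(\Lambda)\cong W$ for some spanning tree. Collapsing an edge $e$ of $\Lambda'$ gives the graph of groups in which the endpoints of $e$ are identified to a single vertex, whose group is the fundamental group of the graph of groups formed by $e$ and its endpoints (an amalgamated product $A*_CB$ if $e$ is not a loop, an HNN extension if $e$ is a loop), all other vertex groups, edge groups and edge maps being kept (up to isomorphism and up to inner automorphisms of the vertex groups at the ends of each edge). Call $e$ reducible if it is not a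 loop and its edge group equals the group of its initial vertex or has image equal to the group of its terminal vertex. * $\Lambda'$ results from $\Lambda$ by a reduction if $\Lambda'$ is obtained from $\Lambda$ by collapsing a reducible edge. * $\Lambda'$ results from $\Lambda$ by splitting a vertex group over a finite subgroup if $\Lambda$ is obtained from $\Lambda'$ by collapsing an edge that is not reducible and has finite edge group; that is, a vertex group of $\Lambda$ is replaced by a nontrivial decomposition $A*_CB$ (or an HNN extension) with $C$ finite, and the edges at that vertex are attached accordingly. Theorem. Let $W$ be a finitely generated Coxeter group. Then there is no infinite sequence $\Lambda_0,\Lambda_1,\Lambda_2,\dots$ of graphs of groups such that $\Lambda_0$ is a decomposition of $W$ with finite underlying graph and finite edge groups (for example $W$ itself as a single vertex group) and such that, for every $n\ge 0$, $\Lambda_{n+1}$ results from $\Lambda_n$ by splitting a vertex group over a finite subgroup or by a reduction. -/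

import Mathlib

universe u v

/-- Two vertices of the (multi)graph with edge set `E`, initial vertices `s` and terminal vertices
`t` are joined by an (unoriented) edge path all of whose edges lie in `X`. -/
def EdgeJoined {V E : Type u} (s t : E → V) (X : Set E) : V → V → Prop :=
  Relation.EqvGen fun a b => ∃ e ∈ X, s e = a ∧ t e = b

/-- A graph of groups: a connected graph (loops and multiple edges are allowed) with vertex groups
`G a`, edge groups that are subgroups of the group of the initial vertex of the edge, and
injective homomorphisms (edge maps) into the group of its terminal vertex. -/
structure GraphOfGroups where
  /-- vertices -/
  V : Type u
  /-- edges -/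
  E : Type u
  /-- initial vertex of an edge -/
  src : E → V
  /-- terminal vertex of an edge -/
  tgt : E → V
  nonempty : Nonempty V
  connected : ∀ a b, EdgeJoined src tgt Set.univ a b
  /-- vertex groups -/
  G : V → Type v
  grp : ∀ a, Group (G a)
  /-- edge groups -/
  edgeGroup : ∀ e, Subgroup (G (src e))
  /-- edge maps -/
  edgeMap : ∀ e, edgeGroup e →* G (tgt e)
  edgeMap_injective : ∀ e, Function.Injective (edgeMap e)

namespace GraphOfGroups

instance instGroupVertex (Λ : GraphOfGroups.{u, v}) (a : Λ.V) : Group (Λ.G a) := Λ.grp a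

/-- The edges in `T` form a spanning tree: they join any two vertices, and no edge of `T` can be
left out (the endpoints of `e ∈ T` are not joined by the other edges of `T`). -/
def IsSpanningTree (Λ : GraphOfGroups.{u, v}) (T : Set Λ.E) : Prop :=
  (∀ a b, EdgeJoined Λ.src Λ.tgt T a b) ∧
    ∀ e ∈ T, ¬ EdgeJoined Λ.src Λ.tgt (T \ {e}) (Λ.src e) (Λ.tgt e)

/-- Generators of the fundamental group: the disjoint union of the vertex groups, and a symbol
for each edge. -/
abbrev Gen (Λ : GraphOfGroups.{u, v}) : Type (max u v) := (Σ a : Λ.V, Λ.G a) ⊕ Λ.E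

/-- The generator given by an element of a vertex group. -/
def genVertex (Λ : GraphOfGroups.{u, v}) (a : Λ.V) (g : Λ.G a) : FreeGroup Λ.Gen :=
  FreeGroup.of (Sum.inl ⟨a, g⟩)

/-- The generator given by an edge. -/
def genEdge (Λ : GraphOfGroups.{u, v}) (e : Λ.E) : FreeGroup Λ.Gen :=
  FreeGroup.of (Sum.inr e)

/-- Relators of the fundamental group: those of the vertex groups, `g t_e = t_e (edgeMap e g)`
for `g` in the edge group of `e`, and `t_e = 1` for `e ∈ T`. -/
inductive Relator (Λ : GraphOfGroups.{u, v}) (T : Set Λ.E) : FreeGroup Λ.Gen → Prop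
  | vertex (a : Λ.V) (g h : Λ.G a) :
      Relator Λ T (Λ.genVertex a g * Λ.genVertex a h * (Λ.genVertex a (g * h))⁻¹)
  | edge (e : Λ.E) (g : Λ.edgeGroup e) :
      Relator Λ T (Λ.genVertex (Λ.src e) g * Λ.genEdge e *
        (Λ.genEdge e * Λ.genVertex (Λ.tgt e) (Λ.edgeMap e g))⁻¹)
  | tree (e : Λ.E) (he : e ∈ T) : Relator Λ T (Λ.genEdge e)

/-- The fundamental group of a graph of groups, with respect to the spanning tree `T`. -/
abbrev FundamentalGroup (Λ : GraphOfGroups.{u, v}) (T : Set Λ.E) : Type (max u v) :=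
  PresentedGroup {r | Relator Λ T r}

/-- The canonical homomorphism from a vertex group to the fundamental group. -/
def ofVertex (Λ : GraphOfGroups.{u, v}) (T : Set Λ.E) (a : Λ.V) :
    Λ.G a →* Λ.FundamentalGroup T :=
  MonoidHom.mk' (fun g => PresentedGroup.mk _ (Λ.genVertex a g)) fun g h => by
    have := (PresentedGroup.mk_eq_one_iff (rels := {r | Relator Λ T r})).2
      (Subgroup.subset_normalClosure (Relator.vertex a g h))
    rw [map_mul, map_inv, mul_inv_eq_one, map_mul] at this
    exact this.symm

/-- `Λ` is a graph of groups decomposition of the group `W`. -/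
def IsDecomposition (Λ : GraphOfGroups.{u, v}) (W : Type*) [Group W] : Prop :=
  ∃ T : Set Λ.E, Λ.IsSpanningTree T ∧ Nonempty (Λ.FundamentalGroup T ≃* W)

/-- The sub-graph of groups of `Λ` that consists of the edge `e` and its endpoints. -/
def edgeSubgraph (Λ : GraphOfGroups.{u, v}) (e : Λ.E) : GraphOfGroups.{u, v} where
  V := {a : Λ.V // a = Λ.src e ∨ a = Λ.tgt e}
  E := PUnit
  src _ := ⟨Λ.src e, Or.inl rfl⟩
  tgt _ := ⟨Λ.tgt e, Or.inr rfl⟩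
  nonempty := ⟨⟨Λ.src e, Or.inl rfl⟩⟩
  connected := by
    have h : EdgeJoined (fun _ : PUnit => (⟨Λ.src e, Or.inl rfl⟩ :
        {a : Λ.V // a = Λ.src e ∨ a = Λ.tgt e})) (fun _ => ⟨Λ.tgt e, Or.inr rfl⟩) Set.univ
        ⟨Λ.src e, Or.inl rfl⟩ ⟨Λ.tgt e, Or.inr rfl⟩ :=
      Relation.EqvGen.rel _ _ ⟨PUnit.unit, trivial, rfl, rfl⟩
    rintro ⟨a, rfl | rfl⟩ ⟨b, hb | hb⟩ <;> subst hb
    exacts [Relation.EqvGen.refl _, h, Relation.EqvGen.symm _ _ h, Relation.EqvGen.refl _]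
  G a := Λ.G a.1
  grp a := Λ.grp a.1
  edgeGroup _ := Λ.edgeGroup e
  edgeMap _ := Λ.edgeMap e
  edgeMap_injective _ := Λ.edgeMap_injective e

/-- The data showing that `Λ` results from `Λ'` by collapsing the edge `e`. The endpoints of `e`
are identified to one vertex, whose group is the fundamental group of the graph of groups formed
by `e` and its endpoints (an amalgamated product if `e` is not a loop, an HNN extension if it is);
the other vertex groups and the remaining edges with their edge groups and edge maps are kept, up
to isomorphism, and up to inner automorphisms of the vertex groups at the two ends of an edge.

Equivalently, `Λ'` results from `Λ` by replacing a vertex by a compatible one-edge decomposition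
of its vertex group: each edge group incident at the vertex is conjugate, in the vertex group, to
a subgroup of a vertex group of that decomposition, to which the edge is then attached. -/
structure EdgeCollapse (Λ' : GraphOfGroups.{u, v}) (e : Λ'.E) (Λ : GraphOfGroups.{u, v}) where
  /-- the map on vertices -/
  q : Λ'.V → Λ.V
  q_surjective : Function.Surjective q
  q_eq_iff : ∀ a b, q a = q b ↔
    a = b ∨ (a = Λ'.src e ∧ b = Λ'.tgt e) ∨ (a = Λ'.tgt e ∧ b = Λ'.src e)
  /-- the remaining edges -/
  σ : Λ.E ≃ {f : Λ'.E // f ≠ e}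
  src_eq : ∀ f, q (Λ'.src (σ f)) = Λ.src f
  tgt_eq : ∀ f, q (Λ'.tgt (σ f)) = Λ.tgt f
  /-- the homomorphisms of vertex groups -/
  φ : ∀ (a : Λ'.V) (b : Λ.V), q a = b → (Λ'.G a →* Λ.G b)
  φ_bijective : ∀ (a b) (h : q a = b), a ≠ Λ'.src e → a ≠ Λ'.tgt e →
    Function.Bijective (φ a b h)
  /-- a spanning tree of the subgraph formed by `e` -/
  T : Set (Λ'.edgeSubgraph e).E
  isSpanningTree : (Λ'.edgeSubgraph e).IsSpanningTree T
  /-- the group of the new vertex -/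
  θ : (Λ'.edgeSubgraph e).FundamentalGroup T ≃* Λ.G (q (Λ'.src e))
  θ_ofVertex : ∀ (a : (Λ'.edgeSubgraph e).V) (h : q a.1 = q (Λ'.src e)) (g : Λ'.G a.1),
    θ ((Λ'.edgeSubgraph e).ofVertex T a g) = φ a.1 (q (Λ'.src e)) h g
  /-- the conjugating elements at the initial ends of the edges -/
  c : ∀ f : Λ.E, Λ.G (Λ.src f)
  /-- the conjugating elements at the terminal ends of the edges -/
  d : ∀ f : Λ.E, Λ.G (Λ.tgt f)
  edgeGroup_eq : ∀ f, Λ.edgeGroup f = (Λ'.edgeGroup (σ f)).map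
    ((MulAut.conj (c f)).toMonoidHom.comp (φ _ _ (src_eq f)))
  edgeMap_eq : ∀ (f) (x : Λ'.edgeGroup (σ f)) (y : Λ.edgeGroup f),
    (y : Λ.G (Λ.src f)) = c f * φ _ _ (src_eq f) x * (c f)⁻¹ →
    Λ.edgeMap f y = d f * φ _ _ (tgt_eq f) (Λ'.edgeMap (σ f) x) * (d f)⁻¹

/-- The edge `e` is not a loop, and its edge group is equal to the group of its initial vertex or
has image equal to the group of its terminal vertex. -/
def IsReducibleEdge (Λ : GraphOfGroups.{u, v}) (e : Λ.E) : Prop :=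
  Λ.src e ≠ Λ.tgt e ∧ (Λ.edgeGroup e = ⊤ ∨ Function.Surjective (Λ.edgeMap e))

/-- `Λ'` results from `Λ` by a reduction, collapsing a vertex across an edge. -/
def Reduces (Λ Λ' : GraphOfGroups.{u, v}) : Prop :=
  ∃ e : Λ.E, Λ.IsReducibleEdge e ∧ Nonempty (EdgeCollapse Λ e Λ')

/-- `Λ'` results from `Λ` by splitting one vertex group nontrivially over a finite subgroup, as an
amalgamated product `A *_C B` with `A ≠ C ≠ B`, or as an HNN extension. -/
def SplitsOverFinite (Λ Λ' : GraphOfGroups.{u, v}) : Prop :=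
  ∃ e : Λ'.E, Finite (Λ'.edgeGroup e) ∧ ¬ Λ'.IsReducibleEdge e ∧ Nonempty (EdgeCollapse Λ' e Λ)

end GraphOfGroups

/-- Accessibility of `W` with respect to splittings over finite groups: there is no infinite
sequence of graphs of groups that starts at a finite graph of groups decomposition of `W` with
finite edge groups (for instance at `W` itself, as a single vertex group) and in which each term
results from the one before by a splitting of a vertex group over a finite subgroup or by a
reduction. All terms are then decompositions of `W`, since collapsing an edge does not change the
fundamental group. -/
def IsAccessible (W : Type*) [Group W] : Prop :=
  ¬ ∃ Λ : ℕ → GraphOfGroups.{u, v},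
    (Λ 0).IsDecomposition W ∧ Finite (Λ 0).V ∧ Finite (Λ 0).E ∧
    (∀ e, Finite ((Λ 0).edgeGroup e)) ∧
    ∀ n, (Λ n).SplitsOverFinite (Λ (n + 1)) ∨ (Λ n).Reduces (Λ (n + 1))

-- Two facts combine: a finitely generated Coxeter group is a group of integer matrices, and
-- finitely generated groups of integer matrices are accessible.
--
-- Integer matrices: the geometric representation is faithful because a root `w α_i` is nonnegative
-- whenever `w s_i` is longer than `w` (`geomRep_root_nonneg`). The numbers `2 cos (π / m)` are
-- algebraic integers, so they generate a ring R that is finite over ℤ. The R-span of the simple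
-- roots is then an invariant free ℤ-module of finite rank (`exists_injective_integer_matrices`).
-- Such a group has finite quotients injective on any given finite set, and the orders of its finite
-- subgroups divide a common N (Minkowski, by reduction mod 3).
--
-- Accessibility: let χ be the sum of N/|G_e| over the edges minus the sum of N/|G_a| over the
-- vertices, infinite groups counting 0. A splitting over a finite group raises χ, or does not lower
-- it and removes a vertex with infinite group (`eulerWeight_lt_or`). A reduction keeps both numbers
-- and removes an edge (`eulerWeight_eq_of_isReducibleEdge`). So the process stops once χ is bounded
-- above.
--
-- The bound (`sum_index_le`, `eulerWeight_le`) comes from counting lifts of a finite quotient ψ : W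
-- → Q to the wreath product of ℤ/2 by Q. A lift is determined by its values on a generating set S,
-- so there are at most 2^(|S||Q|). On the other hand, every edge symbol may be altered by a
-- function on Q invariant under the image of its edge group; up to conjugation at the vertices this
-- gives lifts, and the conjugators are ambiguous only by functions invariant under the images of
-- the vertex groups. Comparing exponents and dividing by |Q| bounds the sum of 1/|ψ(G_e)| by |S|
-- plus the sum of 1/|ψ(G_a)|.
--
-- Instead of normal forms or Bass–Serre trees, all this uses a universal property,
-- `Rep.IsUniversal`, which does not mention spanning trees and passes through edge collapses in
-- both directions.

universe w x

/-! ### Representations of graphs of groups and universality -/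

namespace GraphOfGroups

/-- A representation of a graph of groups in a group `P`: homomorphisms of the vertex groups and
elements for the edges that satisfy the edge relations of the fundamental group. -/
@[ext]
structure Rep (Λ : GraphOfGroups.{u, v}) (P : Type*) [Group P] where
  /-- the homomorphisms of the vertex groups -/
  hom : ∀ a, Λ.G a →* P
  /-- the images of the edge symbols -/
  edge : Λ.E → P
  comm : ∀ (e : Λ.E) (g : Λ.edgeGroup e),
    hom (Λ.src e) g * edge e = edge e * hom (Λ.tgt e) (Λ.edgeMap e g)

namespace Rep

variable {Λ : GraphOfGroups.{u, v}} {P Q R : Type*} [Group P] [Group Q] [Group R]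

/-- The composition of a representation with a homomorphism. -/
def map (p : Λ.Rep P) (π : P →* Q) : Λ.Rep Q where
  hom a := π.comp (p.hom a)
  edge e := π (p.edge e)
  comm e g := by
    have := congrArg π (p.comm e g)
    rwa [map_mul, map_mul] at this

/-- Conjugation of a representation by elements attached to the vertices. -/
def conj (p : Λ.Rep P) (c : Λ.V → P) : Λ.Rep P where
  hom a := (MulAut.conj (c a)).toMonoidHom.comp (p.hom a)
  edge e := c (Λ.src e) * p.edge e * (c (Λ.tgt e))⁻¹
  comm e g := by
    have := p.comm e g
    simp only [MonoidHom.comp_apply, MulEquiv.coe_toMonoidHom, MulAut.conj_apply]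
    calc _ = c (Λ.src e) * (p.hom (Λ.src e) g * p.edge e) * (c (Λ.tgt e))⁻¹ := by group
      _ = _ := by rw [this]; group

@[simp] lemma map_hom (p : Λ.Rep P) (π : P →* Q) (a : Λ.V) (g : Λ.G a) :
    (p.map π).hom a g = π (p.hom a g) := rfl

@[simp] lemma map_edge (p : Λ.Rep P) (π : P →* Q) (e : Λ.E) :
    (p.map π).edge e = π (p.edge e) := rfl

@[simp] lemma conj_hom (p : Λ.Rep P) (c : Λ.V → P) (a : Λ.V) (g : Λ.G a) :
    (p.conj c).hom a g = c a * p.hom a g * (c a)⁻¹ := rfl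

@[simp] lemma conj_edge (p : Λ.Rep P) (c : Λ.V → P) (e : Λ.E) :
    (p.conj c).edge e = c (Λ.src e) * p.edge e * (c (Λ.tgt e))⁻¹ := rfl

lemma ext' {p q : Λ.Rep P} (h : ∀ a g, p.hom a g = q.hom a g) (h' : ∀ e, p.edge e = q.edge e) :
    p = q :=
  Rep.ext (funext fun a => MonoidHom.ext (h a)) (funext h')

lemma map_map (p : Λ.Rep P) (π : P →* Q) (π' : Q →* R) :
    (p.map π).map π' = p.map (π'.comp π) := rfl

lemma map_conj (p : Λ.Rep P) (c : Λ.V → P) (π : P →* Q) :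
    (p.conj c).map π = (p.map π).conj fun a => π (c a) :=
  ext' (by simp) (by simp)

lemma conj_conj (p : Λ.Rep P) (c d : Λ.V → P) :
    (p.conj c).conj d = p.conj (d * c) :=
  ext' (by simp [mul_assoc]) (by simp [mul_assoc])

lemma conj_one (p : Λ.Rep P) : p.conj 1 = p :=
  ext' (by simp) (by simp)

/-- The representation `r` in `W` is universal: representations in other groups factor through it
up to conjugation at the vertices, and in a way that lifts a given factorization of a quotient. -/
def IsUniversal {W : Type w} [Group W] (r : Λ.Rep W) : Prop :=
  ∀ (P Q : Type x) [Group P] [Group Q] (π : P →* Q), Function.Surjective π →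
    ∀ (ψ : W →* Q) (p : Λ.Rep P), p.map π = r.map ψ →
      ∃ (F : W →* P) (c : Λ.V → P), (∀ a, π (c a) = 1) ∧ π.comp F = ψ ∧ p = (r.map F).conj c

lemma IsUniversal.exists_conj {W : Type w} [Group W] {r : Λ.Rep W} (hr : IsUniversal.{u, v, _, x} r)
    {P : Type x} [Group P] (p : Λ.Rep P) :
    ∃ (F : W →* P) (c : Λ.V → P), p = (r.map F).conj c := by
  obtain ⟨F, c, -, -, h⟩ := hr P PUnit 1 (fun _ => ⟨1, rfl⟩) 1 p (ext' (by simp) (by simp))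
  exact ⟨F, c, h⟩

lemma IsUniversal.conj {W : Type w} [Group W] {r : Λ.Rep W} (hr : IsUniversal.{u, v, _, x} r)
    (k : Λ.V → W) : IsUniversal.{u, v, _, x} (r.conj k) := by
  intro P Q _ _ π hπ ψ p hp
  -- Conjugating `p` by lifts of the elements `ψ (k a)` removes the twist by `k` over Q, so that the
  -- universality of `r` applies.
  choose l hl using fun a => hπ (ψ (k a))
  obtain ⟨F, c, hc, hF, h⟩ := hr P Q π hπ ψ (p.conj l⁻¹) (by
    rw [map_conj, hp, map_conj, conj_conj]
    convert conj_one _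
    ext a
    simp [hl])
  refine ⟨F, fun a => l a * c a * (F (k a))⁻¹, fun a => ?_, hF, ?_⟩
  · have : π (F (k a)) = ψ (k a) := by rw [← hF]; rfl
    simp [hc, hl, this]
  · have h2 : p = ((r.map F).conj c).conj l := by
      rw [← h, conj_conj, mul_inv_cancel, conj_one]
    rw [h2, map_conj, conj_conj, conj_conj]
    congr 1
    ext a
    simp

lemma IsUniversal.map_equiv {W : Type w} {W' : Type*} [Group W] [Group W'] {r : Λ.Rep W}
    (hr : IsUniversal.{u, v, _, x} r) (θ : W ≃* W') :
    IsUniversal.{u, v, _, x} (r.map θ.toMonoidHom) := by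
  intro P Q _ _ π hπ ψ p hp
  obtain ⟨F, c, hc, hF, h⟩ := hr P Q π hπ (ψ.comp θ.toMonoidHom) p hp
  refine ⟨F.comp θ.symm.toMonoidHom, c, hc, ?_, ?_⟩
  · rw [← MonoidHom.comp_assoc, hF]
    ext; simp
  · rw [h, map_map]
    congr 2
    ext; simp

end Rep

/-- Elements attached to the edges of a finite forest are coboundaries. -/
lemma exists_potential {V E : Type u} (s t : E → V) {P : Type*} [Group P] (m : E → P)
    (T : Finset E)
    (hT : ∀ e ∈ T, ¬ EdgeJoined s t ((T : Set E) \ {e}) (s e) (t e)) :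
    ∃ c : V → P, ∀ e ∈ T, m e = c (s e) * (c (t e))⁻¹ := by
  classical
  induction T using Finset.induction_on with
  | empty => exact ⟨1, by simp⟩
  | insert e T he ih =>
    have mono : ∀ {X Y : Set E}, X ⊆ Y → ∀ {a b}, EdgeJoined s t X a b → EdgeJoined s t Y a b :=
      fun hXY a b h => Relation.EqvGen.mono (fun _ _ ⟨f, hf, h⟩ => ⟨f, hXY hf, h⟩) _ _ h
    obtain ⟨c, hc⟩ := ih fun f hf h => hT f (Finset.mem_insert_of_mem hf)
      (mono (Set.sdiff_subset_sdiff_left (by simp)) h)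
    have hsep : ¬ EdgeJoined s t (T : Set E) (s e) (t e) := fun h =>
      hT e (Finset.mem_insert_self e T) (mono (by
        intro f hf
        exact ⟨by simp [Finset.mem_coe.1 hf], fun h => he (h ▸ hf)⟩) h)
    -- The old potential is kept on the component of `s e` and multiplied on the right by one
    -- constant elsewhere. This preserves the equations of the edges in `T` and is chosen to solve
    -- that of `e`.
    refine ⟨fun a => if EdgeJoined s t (T : Set E) (s e) a then c a else c a * ((c (t e))⁻¹ *
      (m e)⁻¹ * c (s e)), fun f hf => ?_⟩
    rcases Finset.mem_insert.1 hf with rfl | hf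
    · have hr : EdgeJoined s t (T : Set E) (s f) (s f) := Relation.EqvGen.refl _
      simp only [if_pos hr, if_neg hsep]
      group
    · have hj : EdgeJoined s t (T : Set E) (s f) (t f) :=
        Relation.EqvGen.rel _ _ ⟨f, hf, rfl, rfl⟩
      by_cases h : EdgeJoined s t (T : Set E) (s e) (s f)
      · have h' : EdgeJoined s t (T : Set E) (s e) (t f) := Relation.EqvGen.trans _ _ _ h hj
        simp only [if_pos h, if_pos h', hc f hf]
      · have h' : ¬ EdgeJoined s t (T : Set E) (s e) (t f) := fun h' =>
          h (Relation.EqvGen.trans _ _ _ h' (Relation.EqvGen.symm _ _ hj))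
        simp only [if_neg h, if_neg h', hc f hf]
        group

/-! ### Universality of the fundamental group -/

section FundamentalGroup

variable (Λ : GraphOfGroups.{u, v}) (T : Set Λ.E)

/-- The element of the fundamental group given by an edge. -/
def ofEdge (e : Λ.E) : Λ.FundamentalGroup T := PresentedGroup.mk _ (Λ.genEdge e)

variable {Λ T} in
lemma mk_eq_one_of_relator {w : FreeGroup Λ.Gen} (h : Relator Λ T w) :
    PresentedGroup.mk {r | Relator Λ T r} w = 1 :=
  PresentedGroup.mk_eq_one_iff.2 (Subgroup.subset_normalClosure h)

/-- The canonical representation in the fundamental group. -/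
def canonicalRep : Λ.Rep (Λ.FundamentalGroup T) where
  hom := Λ.ofVertex T
  edge := Λ.ofEdge T
  comm e g := by
    have := mk_eq_one_of_relator (T := T) (Relator.edge e g)
    rwa [map_mul, map_inv, mul_inv_eq_one, map_mul, map_mul] at this

lemma ofEdge_of_mem {e : Λ.E} (he : e ∈ T) : Λ.ofEdge T e = 1 :=
  mk_eq_one_of_relator (Relator.tree e he)

variable {Λ T} in
lemma FundamentalGroup.hom_ext {P : Type*} [Group P] {F F' : Λ.FundamentalGroup T →* P}
    (h : ∀ a g, F (Λ.ofVertex T a g) = F' (Λ.ofVertex T a g))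
    (h' : ∀ e, F (Λ.ofEdge T e) = F' (Λ.ofEdge T e)) : F = F' := by
  refine PresentedGroup.ext fun x => ?_
  rcases x with ⟨a, g⟩ | e
  · exact h a g
  · exact h' e

lemma exists_lift {P : Type*} [Group P] (p : Λ.Rep P) (hp : ∀ e ∈ T, p.edge e = 1) :
    ∃ F : Λ.FundamentalGroup T →* P, (Λ.canonicalRep T).map F = p := by
  let f : Λ.Gen → P := Sum.elim (fun x => p.hom x.1 x.2) p.edge
  have hv : ∀ a g, FreeGroup.lift f (Λ.genVertex a g) = p.hom a g := fun a g => by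
    simp [genVertex, f]
  have he : ∀ e, FreeGroup.lift f (Λ.genEdge e) = p.edge e := fun e => by
    simp [genEdge, f]
  have hf : ∀ r ∈ {r | Relator Λ T r}, FreeGroup.lift f r = 1 := by
    rintro _ (⟨a, g, h⟩ | ⟨e, g⟩ | ⟨e, h⟩)
    · simp [hv]
    · rw [map_mul, map_inv, mul_inv_eq_one, map_mul, map_mul, hv, he, hv, p.comm]
    · rw [he, hp e h]
  refine ⟨PresentedGroup.toGroup hf, Rep.ext' (fun a g => ?_) fun e => ?_⟩
  · exact hv a g
  · exact he e

theorem isUniversal_canonicalRep [Finite Λ.E] (hT : Λ.IsSpanningTree T) :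
    Rep.IsUniversal.{u, v, _, x} (Λ.canonicalRep T) := by
  classical
  intro P Q _ _ π hπ ψ p hp
  have hker : ∀ e ∈ T, π (p.edge e) = 1 := fun e he => by
    have := congrArg (fun r => r.edge e) hp
    simpa [canonicalRep, ofEdge_of_mem Λ T he] using this
  have hfin : T.Finite := Set.toFinite T
  -- The potential is taken in the kernel of `π`, so that the conjugators become trivial in Q. It
  -- makes the tree edges trivial, as a lift to the fundamental group requires.
  obtain ⟨c, hc⟩ := exists_potential Λ.src Λ.tgt
    (fun e => (if h : e ∈ T then ⟨p.edge e, hker e h⟩ else 1 : π.ker)) hfin.toFinset (by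
      simpa using hT.2)
  have hc1 : ∀ a, π (c a) = 1 := fun a => (c a).2
  have hc' : ∀ e ∈ T, p.edge e = c (Λ.src e) * (c (Λ.tgt e) : P)⁻¹ := fun e he => by
    have := congrArg Subtype.val (hc e (by simpa using he))
    simpa [he] using this
  obtain ⟨F, hF⟩ := exists_lift Λ T (p.conj fun a => (c a : P)⁻¹) fun e he => by
    simp [hc' e he]
  have hmap : p = ((Λ.canonicalRep T).map F).conj fun a => (c a : P) := by
    rw [hF, Rep.conj_conj]
    convert (Rep.conj_one p).symm
    ext a
    simp
  refine ⟨F, fun a => c a, hc1, ?_, hmap⟩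
  have key : (Λ.canonicalRep T).map (π.comp F) = (Λ.canonicalRep T).map ψ := by
    rw [← hp, ← Rep.map_map, hF, Rep.map_conj]
    exact Rep.ext' (by simp [hc1]) (by simp [hc1])
  exact FundamentalGroup.hom_ext (fun a g => congrArg (fun r => r.hom a g) key)
    fun e => congrArg (fun r => r.edge e) key

end FundamentalGroup

end GraphOfGroups

/-! ### Universal representations and edge collapses -/

namespace GraphOfGroups

lemma mul_conj_comm {P : Type*} [Group P] {c x s d y : P}
    (h : c * x * c⁻¹ * s = s * (d * y * d⁻¹)) : x * (c⁻¹ * s * d) = c⁻¹ * s * d * y :=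
  calc x * (c⁻¹ * s * d) = c⁻¹ * (c * x * c⁻¹ * s) * d := by group
    _ = _ := by rw [h]; group

namespace EdgeCollapse

variable {Λ' Λ : GraphOfGroups.{u, v}} {e : Λ'.E} (C : EdgeCollapse Λ' e Λ)
  {P Q : Type*} [Group P] [Group Q]

lemma hom_φ (p : Λ.Rep P) {a : Λ'.V} {b : Λ.V} (h : C.q a = b) (g : Λ'.G a) :
    p.hom (C.q a) (C.φ a (C.q a) rfl g) = p.hom b (C.φ a b h g) := by
  subst h; rfl

lemma q_src_eq_q_tgt : C.q (Λ'.src e) = C.q (Λ'.tgt e) :=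
  (C.q_eq_iff _ _).2 (Or.inr (Or.inl ⟨rfl, rfl⟩))

lemma eq_or_eq_of_q_eq {a : Λ'.V} (h : C.q a = C.q (Λ'.src e)) :
    a = Λ'.src e ∨ a = Λ'.tgt e := by
  rcases (C.q_eq_iff _ _).1 h with h | h | h <;> tauto

/-- The element of the new vertex group that is given by the collapsed edge. -/
def edgeElement : Λ.G (C.q (Λ'.src e)) := C.θ ((Λ'.edgeSubgraph e).ofEdge C.T PUnit.unit)

lemma edgeElement_eq_one (h : Λ'.src e ≠ Λ'.tgt e) : C.edgeElement = 1 := by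
  have hT : PUnit.unit ∈ C.T := by
    by_contra hT
    have key : ∀ a b, EdgeJoined (Λ'.edgeSubgraph e).src (Λ'.edgeSubgraph e).tgt C.T a b →
        a = b := by
      intro a b hab
      induction hab with
      | rel _ _ h => obtain ⟨⟨⟩, hf, -⟩ := h; exact absurd hf hT
      | refl => rfl
      | symm _ _ _ ih => exact ih.symm
      | trans _ _ _ _ _ ih ih' => exact ih.trans ih'
    exact h (congrArg Subtype.val (key _ _ (C.isSpanningTree.1 ⟨_, Or.inl rfl⟩ ⟨_, Or.inr rfl⟩)))
  rw [edgeElement, ofEdge_of_mem _ _ hT, map_one]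

lemma φ_mul_edgeElement (g : Λ'.edgeGroup e) :
    C.φ (Λ'.src e) _ rfl g * C.edgeElement =
      C.edgeElement * C.φ (Λ'.tgt e) _ C.q_src_eq_q_tgt.symm (Λ'.edgeMap e g) := by
  have := congrArg C.θ (((Λ'.edgeSubgraph e).canonicalRep C.T).comm PUnit.unit g)
  rw [map_mul, map_mul] at this
  rw [← C.θ_ofVertex ⟨_, Or.inl rfl⟩ rfl, ← C.θ_ofVertex ⟨_, Or.inr rfl⟩]
  exact this

open Classical in
/-- A representation of the collapsed graph of groups gives one of the original. -/
noncomputable def pull (p : Λ.Rep P) : Λ'.Rep P where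
  hom a := (p.hom (C.q a)).comp (C.φ a (C.q a) rfl)
  edge f := if h : f = e then p.hom _ C.edgeElement else
    (p.hom _ (C.c (C.σ.symm ⟨f, h⟩)))⁻¹ * p.edge (C.σ.symm ⟨f, h⟩) *
      p.hom _ (C.d (C.σ.symm ⟨f, h⟩))
  comm f g := by
    by_cases h : f = e
    · subst h
      rw [dif_pos rfl]
      simp only [MonoidHom.comp_apply]
      rw [C.hom_φ p C.q_src_eq_q_tgt.symm, ← map_mul, ← map_mul, C.φ_mul_edgeElement]
    · rw [dif_neg h]
      obtain ⟨f', hf'⟩ := C.σ.surjective ⟨f, h⟩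
      obtain rfl : f = (C.σ f').1 := by rw [hf']
      have hs : C.σ.symm ⟨(C.σ f').1, h⟩ = f' := by simp
      rw [hs]
      simp only [MonoidHom.comp_apply]
      rw [C.hom_φ p (C.src_eq f'), C.hom_φ p (C.tgt_eq f')]
      have hy : C.c f' * C.φ _ _ (C.src_eq f') g * (C.c f')⁻¹ ∈ Λ.edgeGroup f' := by
        rw [C.edgeGroup_eq f']
        exact ⟨g, g.2, rfl⟩
      have h1 := C.edgeMap_eq f' g ⟨_, hy⟩ rfl
      have h2 := p.comm f' ⟨_, hy⟩
      rw [h1] at h2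
      simp only [map_mul, map_inv] at h2
      exact mul_conj_comm h2

@[simp] lemma pull_hom (p : Λ.Rep P) (a : Λ'.V) (g : Λ'.G a) :
    (C.pull p).hom a g = p.hom (C.q a) (C.φ a (C.q a) rfl g) := rfl

lemma pull_edge_self (p : Λ.Rep P) : (C.pull p).edge e = p.hom _ C.edgeElement := by
  simp [pull]

lemma pull_edge_σ (p : Λ.Rep P) (f : Λ.E) : (C.pull p).edge (C.σ f) =
    (p.hom _ (C.c f))⁻¹ * p.edge f * p.hom _ (C.d f) := by
  have h : (C.σ f).1 ≠ e := (C.σ f).2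
  have hs : C.σ.symm ⟨(C.σ f).1, h⟩ = f := by simp
  simp only [pull, dif_neg h]
  rw [hs]

lemma edge_cases (f : Λ'.E) : f = e ∨ ∃ f' : Λ.E, f = C.σ f' := by
  by_cases h : f = e
  · exact Or.inl h
  · exact Or.inr ⟨C.σ.symm ⟨f, h⟩, by simp⟩

lemma pull_map (p : Λ.Rep P) (π : P →* Q) : C.pull (p.map π) = (C.pull p).map π := by
  refine Rep.ext' (fun a g => by simp) fun f => ?_
  rcases C.edge_cases f with rfl | ⟨f, rfl⟩
  · simp [pull_edge_self]
  · simp [pull_edge_σ]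

lemma pull_conj (p : Λ.Rep P) (b : Λ.V → P) :
    C.pull (p.conj b) = (C.pull p).conj fun a => b (C.q a) := by
  refine Rep.ext' (fun a g => by simp) fun f => ?_
  rcases C.edge_cases f with rfl | ⟨f, rfl⟩
  · simp [pull_edge_self, C.q_src_eq_q_tgt]
  · simp [pull_edge_σ, C.src_eq, C.tgt_eq, mul_assoc]

lemma hom_ext_new {F F' : Λ.G (C.q (Λ'.src e)) →* P}
    (h : ∀ (a) (h : C.q a = C.q (Λ'.src e)) (g : Λ'.G a), F (C.φ a _ h g) = F' (C.φ a _ h g))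
    (h' : F C.edgeElement = F' C.edgeElement) : F = F' := by
  have key : F.comp C.θ.toMonoidHom = F'.comp C.θ.toMonoidHom := by
    refine FundamentalGroup.hom_ext (fun a g => ?_) fun ⟨⟩ => h'
    have ha : C.q a.1 = C.q (Λ'.src e) := by
      rcases a with ⟨a, rfl | rfl⟩
      exacts [rfl, C.q_src_eq_q_tgt.symm]
    have := C.θ_ofVertex a ha g
    exact (congrArg F this).trans ((h _ ha g).trans (congrArg F' this).symm)
  ext y
  obtain ⟨x, rfl⟩ := C.θ.surjective y
  exact DFunLike.congr_fun key x

lemma pull_injective {p p' : Λ.Rep P} (h : C.pull p = C.pull p') : p = p' := by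
  have hh : ∀ b, p.hom b = p'.hom b := by
    intro b
    obtain ⟨a, rfl⟩ := C.q_surjective b
    have ha : ∀ a g, p.hom (C.q a) (C.φ a _ rfl g) = p'.hom (C.q a) (C.φ a _ rfl g) :=
      fun a g => congrArg (fun r => r.hom a g) h
    by_cases hq : C.q a = C.q (Λ'.src e)
    · rw [hq]
      refine C.hom_ext_new (fun a h g => ?_) ?_
      · rw [← C.hom_φ p h, ← C.hom_φ p' h, ha]
      · rw [← C.pull_edge_self, h, C.pull_edge_self]
    · ext y
      obtain ⟨g, rfl⟩ := (C.φ_bijective a _ rfl (fun h => hq (by rw [h]))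
        (fun h => hq (by rw [h, C.q_src_eq_q_tgt]))).2 y
      exact ha a g
  refine Rep.ext' (fun b g => by rw [hh]) fun f => ?_
  have := congrArg (fun r => r.edge (C.σ f)) h
  simpa [pull_edge_σ, hh] using this

/-- Conjugating elements between pulled back representations come from the collapsed graph. -/
lemma exists_conj_of_pull {p p' : Λ.Rep P} {k : Λ'.V → P} (h : C.pull p = (C.pull p').conj k) :
    ∃ b : Λ.V → P, (∀ a, k a = b (C.q a)) ∧ p = p'.conj b := by
  -- If `e` is not a loop, both pulled back representations send it to 1, which forces equal
  -- conjugators at its two ends.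
  have hk : k (Λ'.src e) = k (Λ'.tgt e) := by
    by_cases hst : Λ'.src e = Λ'.tgt e
    · rw [hst]
    · have := congrArg (fun r => r.edge e) h
      simp only [Rep.conj_edge, pull_edge_self, C.edgeElement_eq_one hst, map_one, mul_one] at this
      exact (mul_inv_eq_one.1 this.symm)
  choose l hl using C.q_surjective
  have hb : ∀ a, k a = k (l (C.q a)) := by
    intro a
    rcases (C.q_eq_iff _ _).1 (hl (C.q a)).symm with h | ⟨h, h'⟩ | ⟨h, h'⟩
    · rw [← h]
    · rw [h', h, hk]
    · rw [h', h, hk]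
  refine ⟨fun b => k (l b), hb, C.pull_injective ?_⟩
  rw [h, pull_conj]
  congr 1
  exact funext hb

/-- The restriction of a representation to the subgraph formed by an edge. -/
def _root_.GraphOfGroups.Rep.restrictEdge (p : Λ'.Rep P) (e : Λ'.E) :
    (Λ'.edgeSubgraph e).Rep P where
  hom a := p.hom a.1
  edge _ := p.edge e
  comm _ := p.comm e

/-- Up to conjugation, every representation is pulled back from the collapsed graph. -/
theorem exists_pull {P Q : Type x} [Group P] [Group Q] {π : P →* Q} (hπ : Function.Surjective π)
    (p' : Λ'.Rep P) (ρ : Λ.Rep Q) (hp : p'.map π = C.pull ρ) :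
    ∃ (p : Λ.Rep P) (k : Λ'.V → P), (∀ a, π (k a) = 1) ∧ p.map π = ρ ∧ p' = (C.pull p).conj k := by
  classical
  have : Finite (Λ'.edgeSubgraph e).E := inferInstanceAs (Finite PUnit)
  have hph : ∀ a g, π (p'.hom a g) = ρ.hom (C.q a) (C.φ a _ rfl g) :=
    fun a g => congrArg (fun r => r.hom a g) hp
  have hpe : ∀ f, π (p'.edge f) = (C.pull ρ).edge f := fun f => congrArg (fun r => r.edge f) hp
  -- Universality of the one-edge subgraph, relative to the quotient in which `ρ` already lives,
  -- gives the homomorphism on the new vertex group.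
  obtain ⟨F, cS, hcS, hF, hp'⟩ := isUniversal_canonicalRep _ C.T C.isSpanningTree P Q π hπ
    ((ρ.hom _).comp C.θ.toMonoidHom) (p'.restrictEdge e) (by
      refine Rep.ext' (fun a g => ?_) fun ⟨⟩ => ?_
      · have ha : C.q a.1 = C.q (Λ'.src e) := by
          rcases a with ⟨a, rfl | rfl⟩
          exacts [rfl, C.q_src_eq_q_tgt.symm]
        have := C.θ_ofVertex a ha g
        exact (hph _ _).trans ((C.hom_φ ρ ha g).trans (congrArg _ this.symm))
      · exact (hpe e).trans (C.pull_edge_self ρ))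
  have hFh : ∀ a g, p'.hom a.1 g = cS a * F ((Λ'.edgeSubgraph e).ofVertex C.T a g) * (cS a)⁻¹ :=
    fun a g => congrArg (fun r => r.hom a g) hp'
  have hFe : p'.edge e = cS ⟨_, Or.inl rfl⟩ * F ((Λ'.edgeSubgraph e).ofEdge C.T PUnit.unit) *
    (cS ⟨_, Or.inr rfl⟩)⁻¹ := congrArg (fun r => r.edge PUnit.unit) hp'
  let k : Λ'.V → P := fun a => if h : a = Λ'.src e ∨ a = Λ'.tgt e then cS ⟨a, h⟩ else 1
  have hk : ∀ a, π (k a) = 1 := by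
    intro a
    by_cases h : a = Λ'.src e ∨ a = Λ'.tgt e
    · simp only [k, dif_pos h]
      exact hcS _
    · simp only [k, dif_neg h, map_one]
  -- The last clause records the value at the collapsed edge symbol; the cast is there because `b`
  -- is only propositionally the new vertex.
  have hhom : ∀ b, ∃ t : Λ.G b →* P,
      (∀ (a) (h : C.q a = b) (g), p'.hom a g = k a * t (C.φ a b h g) * (k a)⁻¹) ∧
      π.comp t = ρ.hom b ∧
      ∀ (h : C.q (Λ'.src e) = b) (y), t (cast (congrArg Λ.G h) (C.θ y)) = F y := by
    intro b
    by_cases hb : C.q (Λ'.src e) = b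
    · subst hb
      refine ⟨F.comp C.θ.symm.toMonoidHom, fun a h g => ?_, ?_, fun _ y => ?_⟩
      · have ha := C.eq_or_eq_of_q_eq h
        have := C.θ_ofVertex ⟨a, ha⟩ h g
        simp only [k, dif_pos ha, ← this]
        simpa using hFh ⟨a, ha⟩ g
      · rw [← MonoidHom.comp_assoc, hF]
        ext y
        simp
      · simp
    · obtain ⟨a, rfl⟩ := C.q_surjective b
      have ha : ¬ (a = Λ'.src e ∨ a = Λ'.tgt e) := by
        rintro (rfl | rfl)
        · exact hb rfl
        · exact hb C.q_src_eq_q_tgt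
      let ε := MulEquiv.ofBijective (C.φ a _ rfl)
        (C.φ_bijective a _ rfl (fun h => ha (Or.inl h)) (fun h => ha (Or.inr h)))
      refine ⟨(p'.hom a).comp ε.symm.toMonoidHom, fun a' h g => ?_, ?_, fun h => absurd h hb⟩
      · obtain rfl : a' = a := by
          rcases (C.q_eq_iff _ _).1 h with h | ⟨-, h⟩ | ⟨-, h⟩
          · exact h
          · exact absurd (Or.inr h) ha
          · exact absurd (Or.inl h) ha
        simp only [k, dif_neg ha]
        have : ε.symm (C.φ a' (C.q a') rfl g) = g := ε.symm_apply_apply g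
        simp [this]
      · ext y
        obtain ⟨g, rfl⟩ := ε.surjective y
        simp only [MonoidHom.comp_apply, MulEquiv.coe_toMonoidHom, MulEquiv.symm_apply_apply, hph]
        rfl
  choose t ht htπ htF using hhom
  have htF' : t _ C.edgeElement = F ((Λ'.edgeSubgraph e).ofEdge C.T PUnit.unit) :=
    htF _ rfl ((Λ'.edgeSubgraph e).ofEdge C.T PUnit.unit)
  have htπ' : ∀ b y, π (t b y) = ρ.hom b y := fun b y => DFunLike.congr_fun (htπ b) y
  -- The edge values are obtained by solving `p' = (C.pull p).conj k` for them.
  let p : Λ.Rep P :=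
    { hom := t
      edge := fun f => t _ (C.c f) * ((k (Λ'.src (C.σ f)))⁻¹ * p'.edge (C.σ f) *
        k (Λ'.tgt (C.σ f))) * (t _ (C.d f))⁻¹
      comm := by
        intro f y
        obtain ⟨x, hx, hxy⟩ := (C.edgeGroup_eq f).le y.2
        rw [C.edgeMap_eq f ⟨x, hx⟩ y hxy.symm, ← hxy]
        have h1 := p'.comm (C.σ f) ⟨x, hx⟩
        rw [ht _ _ (C.src_eq f), ht _ _ (C.tgt_eq f)] at h1
        simp only [MonoidHom.comp_apply, MulEquiv.coe_toMonoidHom, MulAut.conj_apply, map_mul,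
          map_inv]
        calc _ = t _ (C.c f) * (k (Λ'.src (C.σ f)))⁻¹ * ((k (Λ'.src (C.σ f))) *
              t _ (C.φ _ _ (C.src_eq f) x) * (k (Λ'.src (C.σ f)))⁻¹ * p'.edge (C.σ f)) *
              k (Λ'.tgt (C.σ f)) * (t _ (C.d f))⁻¹ := by group
          _ = _ := by rw [h1]; group }
  refine ⟨p, k, hk, Rep.ext' (fun b y => htπ' b y) fun f => ?_, Rep.ext' (fun a g => ?_) fun f => ?_⟩
  · change π (t _ (C.c f) * ((k (Λ'.src (C.σ f)))⁻¹ * p'.edge (C.σ f) *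
        k (Λ'.tgt (C.σ f))) * (t _ (C.d f))⁻¹) = _
    simp [hk, htπ', hpe, pull_edge_σ]
    group
  · exact ht _ a rfl g
  · rcases C.edge_cases f with rfl | ⟨f, rfl⟩
    · rw [Rep.conj_edge, pull_edge_self]
      change _ = k _ * t _ C.edgeElement * _
      rw [htF', hFe]
      simp only [k, dif_pos (Or.inl rfl : Λ'.src f = Λ'.src f ∨ Λ'.src f = Λ'.tgt f),
        dif_pos (Or.inr rfl : Λ'.tgt f = Λ'.src f ∨ Λ'.tgt f = Λ'.tgt f)]
    · rw [Rep.conj_edge, pull_edge_σ]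
      change _ = k _ * ((t _ (C.c f))⁻¹ * (t _ (C.c f) * ((k (Λ'.src (C.σ f)))⁻¹ *
        p'.edge (C.σ f) * k (Λ'.tgt (C.σ f))) * (t _ (C.d f))⁻¹) * t _ (C.d f)) * _
      group

theorem isUniversal_pull {W : Type w} [Group W] {r : Λ.Rep W}
    (hr : Rep.IsUniversal.{u, v, _, x} r) : Rep.IsUniversal.{u, v, _, x} (C.pull r) := by
  intro P Q _ _ π hπ ψ p' hp'
  obtain ⟨p, k, hk, hp, h⟩ := C.exists_pull hπ p' (r.map ψ) (by rw [hp', pull_map])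
  obtain ⟨F, c, hc, hF, h'⟩ := hr P Q π hπ ψ p hp
  refine ⟨F, fun a => k a * c (C.q a), fun a => by simp [hk, hc], hF, ?_⟩
  rw [h, h', pull_conj, pull_map, Rep.conj_conj]
  rfl

/-- Reductions need this direction, from the original graph to the collapsed one. The given
representation is conjugate to a pullback, and conjugators between pullbacks descend to the
collapsed graph. -/
theorem exists_isUniversal (C : EdgeCollapse Λ' e Λ) {W : Type w} [Group W] {r' : Λ'.Rep W}
    (hr : Rep.IsUniversal.{u, v, _, x} r') :
    ∃ r : Λ.Rep W, Rep.IsUniversal.{u, v, _, x} r := by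
  obtain ⟨r, k, -, -, h⟩ := C.exists_pull (Q := PUnit) (π := 1) (fun _ => ⟨1, rfl⟩) r'
    ⟨1, 1, fun _ _ => rfl⟩ (Rep.ext' (fun _ _ => rfl) fun _ => rfl)
  have hr' : Rep.IsUniversal.{u, v, _, x} (C.pull r) := by
    have := hr.conj k⁻¹
    rw [h, Rep.conj_conj] at this
    simpa [Rep.conj_one] using this
  refine ⟨r, fun P Q _ _ π hπ ψ p hp => ?_⟩
  obtain ⟨F, c, hc, hF, h⟩ := hr' P Q π hπ ψ (C.pull p) (by rw [← pull_map, hp, pull_map])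
  rw [← pull_map] at h
  obtain ⟨b, hb, h⟩ := C.exists_conj_of_pull h
  refine ⟨F, b, fun a => ?_, hF, h⟩
  obtain ⟨a, rfl⟩ := C.q_surjective a
  rw [← hb, hc]

end EdgeCollapse

end GraphOfGroups

/-! ### Free actions on an infinite set and invariant functions -/

lemma nonempty_prod_equiv_of_embedding {T Ω : Type*} [Infinite Ω] [Nonempty T] (f : T ↪ Ω) :
    Nonempty (T × Ω ≃ Ω) := by
  have h : Cardinal.mk (Ω × Ω) = Cardinal.mk Ω := by
    rw [← Cardinal.mul_def, Cardinal.mul_eq_self (Cardinal.aleph0_le_mk Ω)]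
  obtain ⟨ε⟩ := Cardinal.eq.1 h
  refine Function.Embedding.antisymm ((f.prodMap (.refl Ω)).trans ε.toEmbedding)
    ⟨fun ω => (Classical.arbitrary T, ω), fun _ _ h => congrArg Prod.snd h⟩

/-- The action by left multiplication on the first factor of `G × Ω`, identified with `Ω`. -/
def leftMulPerm {G Ω : Type*} [Group G] (ε : G × Ω ≃ Ω) : G →* Equiv.Perm Ω where
  toFun g := ε.symm.trans (((Equiv.mulLeft g).prodCongr (Equiv.refl Ω)).trans ε)
  map_one' := by ext; simp
  map_mul' g h := by ext; simp [Prod.map]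

lemma leftMulPerm_apply {G Ω : Type*} [Group G] (ε : G × Ω ≃ Ω) (g h : G) (ω : Ω) :
    leftMulPerm ε g (ε (h, ω)) = ε (g * h, ω) := by
  simp [leftMulPerm]

lemma leftMulPerm_injective {G Ω : Type*} [Group G] [Nonempty Ω] (ε : G × Ω ≃ Ω) :
    Function.Injective (leftMulPerm ε) := by
  intro g h hgh
  have := DFunLike.congr_fun hgh (ε (1, Classical.arbitrary Ω))
  rw [leftMulPerm_apply, leftMulPerm_apply] at this
  simpa using this

/-- With a right transversal T of H in G, the set G × Ω is H × (T × Ω), and T × Ω is equipotent with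
Ω. So the restricted free action has the same standard form, whatever the embedding of H. -/
lemma exists_restrict_leftMulPerm {G H Ω : Type*} [Group G] [Group H] [Infinite Ω]
    (ε : G × Ω ≃ Ω) (f : G ↪ Ω) (j : H →* G) (hj : Function.Injective j) :
    ∃ δ : H × Ω ≃ Ω, ∀ g h ω, leftMulPerm ε (j g) (δ (h, ω)) = δ (g * h, ω) := by
  obtain ⟨T, hT, -⟩ := j.range.exists_isComplement_right 1
  have : Nonempty T := hT.nonempty_right.to_subtype
  obtain ⟨κ⟩ := nonempty_prod_equiv_of_embedding ((Function.Embedding.subtype (· ∈ T)).trans f)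
  let μ : H × T ≃ G := ((MonoidHom.ofInjective hj).toEquiv.prodCongr (Equiv.refl T)).trans
    (Equiv.ofBijective _ hT)
  have hμ : ∀ h t, μ (h, t) = j h * t := fun h t => rfl
  refine ⟨((Equiv.refl H).prodCongr κ.symm).trans ((Equiv.prodAssoc _ _ _).symm.trans
    ((μ.prodCongr (Equiv.refl Ω)).trans ε)), fun g h ω => ?_⟩
  simp [leftMulPerm_apply, hμ, mul_assoc]

/-- Functions invariant under left multiplication by a subgroup. -/
def leftInvariant {Q : Type*} [Group Q] (D : Type*) (H : Subgroup Q) : Set (Q → D) :=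
  {m | ∀ h ∈ H, ∀ y, m (h * y) = m y}

/-- Inversion turns functions on the right cosets H y into functions on the quotient by left cosets.
-/
lemma card_leftInvariant {Q : Type*} [Group Q] [Finite Q] (D : Type*) (H : Subgroup Q) :
    Nat.card (leftInvariant D H) = Nat.card D ^ H.index := by
  have e : leftInvariant D H ≃ (Q ⧸ H → D) :=
    { toFun := fun m => Quotient.lift (fun y => m.1 y⁻¹) fun a b hab => by
        have hab' : a⁻¹ * b ∈ H := QuotientGroup.leftRel_apply.1 hab
        have := m.2 _ hab' b⁻¹
        simpa using this
      invFun := fun f => ⟨fun y => f (QuotientGroup.mk y⁻¹), fun h hh y =>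
        congrArg f (QuotientGroup.eq.2 (by simpa using hh))⟩
      left_inv := fun m => by
        ext y
        change m.1 y⁻¹⁻¹ = m.1 y
        rw [inv_inv]
      right_inv := fun f => by
        ext y
        induction y using QuotientGroup.induction_on with
        | H y =>
          change f (QuotientGroup.mk y⁻¹⁻¹) = _
          rw [inv_inv] }
  rw [Nat.card_congr e, Nat.card_fun, Subgroup.index]

lemma mul_inv_mul_comm {G : Type*} [Group G] {a b x z : G} (h : z = a * x * a⁻¹)
    (h' : z = b * x * b⁻¹) : a * b⁻¹ * z = z * (a * b⁻¹) := by
  nth_rewrite 1 [h']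
  rw [h]
  group

/-! ### Injectivity of the vertex groups and the bound on the edges -/

namespace GraphOfGroups

namespace Rep

variable {Λ : GraphOfGroups.{u, v}} {W : Type w} [Group W]

/-- All vertex groups act freely on one large set Ω. The two actions of an edge group, through its
two ends, are both free with orbit set equipotent with Ω, so a permutation intertwines them. This is
a representation that is faithful on every vertex group, and it factors through `r` up to
conjugation. -/
theorem IsUniversal.injective {r : Λ.Rep W} (hr : IsUniversal.{u, v, _, max u v} r) (a : Λ.V) :
    Function.Injective (r.hom a) := by
  let Ω : Type (max u v) := (Σ a, Λ.G a) × ℕ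
  have : Nonempty (Σ a, Λ.G a) := ⟨⟨a, 1⟩⟩
  let f : ∀ a, Λ.G a ↪ Ω := fun a =>
    ⟨fun g => (⟨a, g⟩, 0), fun g h hgh => by
      have := congrArg Prod.fst hgh
      simpa using this⟩
  have ε : ∀ a, Λ.G a × Ω ≃ Ω := fun a => (nonempty_prod_equiv_of_embedding (f a)).some
  choose δ hδ using fun e => exists_restrict_leftMulPerm (ε (Λ.src e)) (f _)
    (Λ.edgeGroup e).subtype (Subgroup.subtype_injective _)
  choose δ' hδ' using fun e => exists_restrict_leftMulPerm (ε (Λ.tgt e)) (f _)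
    (Λ.edgeMap e) (Λ.edgeMap_injective e)
  let p : Λ.Rep (Equiv.Perm Ω) :=
    { hom := fun a => leftMulPerm (ε a)
      edge := fun e => (δ' e).symm.trans (δ e)
      comm := fun e g => by
        ext1 ω
        obtain ⟨⟨h, ω⟩, rfl⟩ := (δ' e).surjective ω
        simp only [Equiv.Perm.mul_apply, Equiv.trans_apply, hδ', Equiv.symm_apply_apply]
        exact hδ e g h ω }
  obtain ⟨F, c, h⟩ := hr.exists_conj p
  intro g g' hg
  refine leftMulPerm_injective (ε a) ?_
  have hp : ∀ g, leftMulPerm (ε a) g = c a * F (r.hom a g) * (c a)⁻¹ :=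
    fun g => congrArg (fun r => r.hom a g) h
  rw [hp, hp, hg]

open scoped Classical in
/-- A bound for the edges of a graph of groups in terms of the number of generators of the
fundamental group, seen in a finite quotient. -/
theorem IsUniversal.sum_index_le [Fintype Λ.V] [Fintype Λ.E] {r : Λ.Rep W}
    (hr : IsUniversal.{u, v, _, x} r)
    {Q : Type x} [Group Q] [Finite Q] (ψ : W →* Q) (S : Finset W)
    (hS : Subgroup.closure (S : Set W) = ⊤) :
    ∑ e, ((Λ.edgeGroup e).map (ψ.comp (r.hom (Λ.src e)))).index ≤
      Nat.card Q * S.card + ∑ a, (ψ.comp (r.hom a)).range.index := by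
  let D := Multiplicative (ZMod 2)
  have hD : Nat.card D = 2 := by simp [D]
  let A := ∀ e, leftInvariant D ((Λ.edgeGroup e).map (ψ.comp (r.hom (Λ.src e))))
  -- Lifts of `r.map ψ`: the edge relation survives the twist by `m e` since `m e` is invariant
  -- under the image of the edge group.
  let p : A → Λ.Rep (D ≀ᵣ Q) := fun m =>
    { hom := fun a => RegularWreathProduct.inl.comp (ψ.comp (r.hom a))
      edge := fun e => ⟨m e, ψ (r.edge e)⟩
      comm := fun e g => by
        ext y
        · have := (m e).2 (ψ (r.hom (Λ.src e) g))⁻¹ (inv_mem ⟨g, g.2, rfl⟩) y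
          simp [this]
        · simp [← map_mul, r.comm] }
  have hπ : Function.Surjective (RegularWreathProduct.rightHom : D ≀ᵣ Q →* Q) :=
    fun q => ⟨RegularWreathProduct.inl q, rfl⟩
  choose F c hc hF h using fun m => hr (D ≀ᵣ Q) Q RegularWreathProduct.rightHom hπ ψ (p m)
    (ext' (fun _ _ => rfl) fun _ => rfl)
  let Φ : A → (S → Q → D) := fun m s => (F m s).left
  have hΦ : ∀ m m', Φ m = Φ m' → F m = F m' := by
    intro m m' hm
    refine MonoidHom.eq_of_eqOn_dense hS fun s hs => ?_
    ext y
    · exact congrFun (congrFun hm ⟨s, hs⟩) y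
    · exact (DFunLike.congr_fun (hF m) s).trans (DFunLike.congr_fun (hF m') s).symm
  have : Nonempty A := ⟨fun e => ⟨1, fun _ _ _ => rfl⟩⟩
  -- A reference element among those with the same homomorphism `F`. Conjugators are compared with
  -- those of the reference.
  let b : A → A := fun m => Function.invFun Φ (Φ m)
  have hb : ∀ m, Φ (b m) = Φ m := fun m => Function.invFun_eq ⟨m, rfl⟩
  -- Both conjugators carry `F m` on the vertex group to the same homomorphism, so their quotient
  -- centralizes its image; for elements of the base this means left invariance.
  have hn : ∀ m a, (c m a * (c (b m) a)⁻¹).left ∈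
      leftInvariant D (ψ.comp (r.hom a)).range := by
    rintro m a _ ⟨g, rfl⟩ y
    have h1 : RegularWreathProduct.inl (ψ (r.hom a g)) = c m a * F m (r.hom a g) * (c m a)⁻¹ :=
      congrArg (fun r => r.hom a g) (h m)
    have h2 : RegularWreathProduct.inl (ψ (r.hom a g)) =
        c (b m) a * F m (r.hom a g) * (c (b m) a)⁻¹ := by
      rw [← hΦ _ _ (hb m)]
      exact congrArg (fun r => r.hom a g) (h (b m))
    have h3 : c m a * (c (b m) a)⁻¹ * RegularWreathProduct.inl (ψ (r.hom a g)) =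
        RegularWreathProduct.inl (ψ (r.hom a g)) * (c m a * (c (b m) a)⁻¹) :=
      mul_inv_mul_comm h1 h2
    have h4 := congrFun (congrArg RegularWreathProduct.left h3) (ψ (r.hom a g) * y)
    have h5 : ∀ m, (c m a).right = 1 := fun m => hc m a
    simpa [h5] using h4
  -- These data recover `F m` and `c m`, hence `p m`, hence `m`.
  let Ψ : A → (S → Q → D) × ∀ a, leftInvariant D (ψ.comp (r.hom a)).range :=
    fun m => (Φ m, fun a => ⟨_, hn m a⟩)
  have hΨ : Function.Injective Ψ := by
    intro m m' hm
    have h1 : Φ m = Φ m' := congrArg Prod.fst hm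
    have hbb : b m = b m' := by simp only [b, h1]
    have h2 : c m = c m' := by
      funext a
      have h3 : (c m a * (c (b m) a)⁻¹).left = (c m' a * (c (b m') a)⁻¹).left :=
        congrArg Subtype.val (congrFun (congrArg Prod.snd hm) a)
      have h5 : ∀ m, (c m a).right = 1 := fun m => hc m a
      rw [hbb] at h3
      ext y
      · simpa [h5] using congrFun h3 y
      · rw [h5, h5]
    have h3 : p m = p m' := by rw [h, h m', h2, hΦ _ _ h1]
    funext e
    exact Subtype.ext (congrArg (fun r => (r.edge e).left) h3)
  have hcard := Nat.card_le_card_of_injective Ψ hΨ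
  simp only [A, Nat.card_prod, Nat.card_pi, card_leftInvariant, Nat.card_fun, hD,
    Finset.prod_pow_eq_pow_sum, ← pow_add] at hcard
  rw [Nat.pow_le_pow_iff_right (by norm_num)] at hcard
  simpa [mul_comm (Nat.card Q)] using hcard

end Rep

end GraphOfGroups

/-! ### Torsion in the kernel of reduction mod 3 -/

section Minkowski

variable {R : Type*} [Ring R]

lemma exists_one_add_pow_eq (x : R) (n : ℕ) : ∃ z, (1 + x) ^ n = 1 + n • x + x * x * z := by
  induction n with
  | zero => exact ⟨0, by simp⟩
  | succ n ih =>
    obtain ⟨z, hz⟩ := ih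
    refine ⟨z + z * x + n • 1, ?_⟩
    rw [pow_succ, hz]
    simp only [nsmul_eq_mul, Nat.cast_add, Nat.cast_one]
    have := (Nat.cast_commute n x).eq
    have h2 : x * x * (n * 1) = n * x * x := by
      rw [mul_one, mul_assoc, ← (Nat.cast_commute n x).eq, ← mul_assoc, this]
    rw [mul_add (x * x), mul_add (x * x), h2]
    noncomm_ring

/-- Expanding the power shows that `q x` is a multiple of x², hence of 3^(2a), and q is invertible
mod 3^(a+1) if it is not 3. For q = 3, the relation 3x = -(3x² + x³) has a right side divisible by
3^(a+2) because a ≥ 1, and 3 is cancelled. -/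
lemma three_pow_succ_dvd_of_pow_eq_one [IsAddTorsionFree R] {q : ℕ} (hq : q.Prime) {x : R}
    (hx : (1 + x) ^ q = 1) {a : ℕ} (ha : 1 ≤ a) {y : R} (hy : x = (3 ^ a : ℤ) • y) :
    ∃ y' : R, x = (3 ^ (a + 1) : ℤ) • y' := by
  obtain ⟨b, rfl⟩ := Nat.exists_eq_add_of_le ha
  by_cases h3 : q = 3
  · subst h3
    have h1 : (3 : ℤ) • x = (3 : ℤ) • ((3 ^ (1 + b + 1) : ℤ) •
        -((3 ^ b : ℤ) • (y * y) + (3 ^ (2 * b) : ℤ) • (y * y * y))) := by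
      have h2 : (3 : ℤ) • x = -((3 : ℤ) • (x * x) + x * x * x) := by
        have : (1 + x) ^ 3 = 1 + ((3 : ℤ) • x + (3 : ℤ) • (x * x) + x * x * x) := by
          noncomm_ring
        rw [this, add_eq_left] at hx
        rw [eq_neg_iff_add_eq_zero, ← hx]
        abel
      rw [h2, hy]
      simp only [smul_mul_assoc, mul_smul_comm, smul_smul, smul_neg, smul_add]
      congr 2
      · congr 1; ring
      · congr 1; ring
    exact ⟨_, zsmul_right_injective (by norm_num) h1⟩
  · obtain ⟨z, hz⟩ := exists_one_add_pow_eq x q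
    have hcop : IsCoprime (q : ℤ) (3 ^ (1 + b + 1)) :=
      IsCoprime.pow_right (Nat.isCoprime_iff_coprime.2
        ((Nat.coprime_primes hq Nat.prime_three).2 h3))
    obtain ⟨s, t, hst⟩ := hcop
    have h1 : (q : ℤ) • x = (3 ^ (1 + b + 1) : ℤ) • -((3 ^ b : ℤ) • (y * y * z)) := by
      have h2 : (q : ℤ) • x = -(x * x * z) := by
        rw [hz, add_assoc, add_eq_left] at hx
        rw [eq_neg_iff_add_eq_zero, ← hx, natCast_zsmul]
      rw [h2, hy]
      simp only [smul_mul_assoc, mul_smul_comm, smul_smul, smul_neg]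
      congr 2; ring
    refine ⟨s • -((3 ^ b : ℤ) • (y * y * z)) + t • x, ?_⟩
    calc x = (s * q + t * 3 ^ (1 + b + 1)) • x := by rw [hst, one_smul]
      _ = s • ((q : ℤ) • x) + t • ((3 ^ (1 + b + 1) : ℤ) • x) := by
        rw [add_smul, mul_smul, mul_smul]
      _ = _ := by
        rw [h1, smul_add, smul_comm s, smul_comm t]

lemma Matrix.eq_one_of_map_eq_one_of_pow_eq_one {n : Type*} [Fintype n] [DecidableEq n] {q : ℕ}
    (hq : q.Prime) {g : Matrix n n ℤ} (h : (Int.castRingHom (ZMod 3)).mapMatrix g = 1)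
    (hg : g ^ q = 1) : g = 1 := by
  have : IsAddTorsionFree (Matrix n n ℤ) := inferInstanceAs (IsAddTorsionFree (n → n → ℤ))
  obtain ⟨x, rfl⟩ : ∃ x, g = 1 + x := ⟨g - 1, by simp⟩
  rw [map_add, map_one, add_eq_left] at h
  have key : ∀ a : ℕ, ∃ y : Matrix n n ℤ, x = (3 ^ (a + 1) : ℤ) • y := by
    intro a
    induction a with
    | zero =>
      have : ∀ i j, ∃ y : ℤ, x i j = 3 * y := fun i j => by
        have h1 : ((x i j : ℤ) : ZMod 3) = 0 := congrFun (congrFun h i) j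
        exact (ZMod.intCast_zmod_eq_zero_iff_dvd _ 3).1 h1
      choose y hy using this
      exact ⟨Matrix.of y, by ext i j; simp [hy]⟩
    | succ a ih =>
      obtain ⟨y, hy⟩ := ih
      exact three_pow_succ_dvd_of_pow_eq_one hq hg (by omega) hy
  rw [add_eq_left]
  ext i j
  -- An entry divisible by a power of 3 that exceeds its absolute value is 0.
  obtain ⟨y, hy⟩ := key (x i j).natAbs
  refine Int.eq_zero_of_abs_lt_dvd (m := 3 ^ ((x i j).natAbs + 1)) ⟨y i j, ?_⟩ ?_
  · nth_rewrite 1 [hy]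
    simp
  · rw [Int.abs_eq_natAbs]
    have : (x i j).natAbs < 3 ^ ((x i j).natAbs + 1) :=
      (Nat.lt_pow_self (by norm_num)).trans (Nat.pow_lt_pow_right (by norm_num) (by omega))
    exact_mod_cast this

end Minkowski

/-! ### Finite quotients and finite subgroups of integer matrix groups -/

section IntegerMatrices

variable {W : Type*} [Group W] {k : Type*} [Fintype k] [DecidableEq k]
  {ρ : W →* Matrix k k ℤ}

theorem exists_finite_quotient_injOn (hρ : Function.Injective ρ) (S : Finset W) :
    ∃ (m : ℕ) (_ : NeZero m) (ψ : W →* (Matrix k k (ZMod m))ˣ), Set.InjOn ψ S := by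
  -- A modulus larger than every difference of entries keeps the elements of `S` apart.
  let m : ℕ := 1 + ∑ s ∈ S, ∑ t ∈ S, ∑ i, ∑ j, (ρ s i j - ρ t i j).natAbs
  refine ⟨m, ⟨by omega⟩, ((Int.castRingHom (ZMod m)).mapMatrix.toMonoidHom.comp ρ).toHomUnits,
    fun s hs t ht h => hρ ?_⟩
  have h1 : (Int.castRingHom (ZMod m)).mapMatrix (ρ s) =
    (Int.castRingHom (ZMod m)).mapMatrix (ρ t) := congrArg Units.val h
  ext i j
  have h2 : ((ρ s i j : ℤ) : ZMod m) = (ρ t i j : ℤ) := congrFun (congrFun h1 i) j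
  have h3 : (m : ℤ) ∣ ρ s i j - ρ t i j := by
    rw [← ZMod.intCast_zmod_eq_zero_iff_dvd, Int.cast_sub, h2, sub_self]
  rw [← sub_eq_zero]
  refine Int.eq_zero_of_abs_lt_dvd h3 ?_
  rw [Int.abs_eq_natAbs]
  have h4 : (ρ s i j - ρ t i j).natAbs ≤
      ∑ s ∈ S, ∑ t ∈ S, ∑ i, ∑ j, (ρ s i j - ρ t i j).natAbs :=
    calc _ ≤ ∑ j, (ρ s i j - ρ t i j).natAbs :=
          Finset.single_le_sum (f := fun j => (ρ s i j - ρ t i j).natAbs)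
            (fun _ _ => Nat.zero_le _) (Finset.mem_univ j)
      _ ≤ ∑ i, ∑ j, (ρ s i j - ρ t i j).natAbs :=
          Finset.single_le_sum (f := fun i => ∑ j, (ρ s i j - ρ t i j).natAbs)
            (fun _ _ => Nat.zero_le _) (Finset.mem_univ i)
      _ ≤ ∑ t ∈ S, ∑ i, ∑ j, (ρ s i j - ρ t i j).natAbs :=
          Finset.single_le_sum (f := fun t => ∑ i, ∑ j, (ρ s i j - ρ t i j).natAbs)
            (fun _ _ => Nat.zero_le _) ht
      _ ≤ _ :=
          Finset.single_le_sum (f := fun s => ∑ t ∈ S, ∑ i, ∑ j, (ρ s i j - ρ t i j).natAbs)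
            (fun _ _ => Nat.zero_le _) hs
  have : (ρ s i j - ρ t i j).natAbs < m := by omega
  exact_mod_cast this

theorem exists_card_finite_dvd (hρ : Function.Injective ρ) :
    ∃ N : ℕ, 0 < N ∧ ∀ (H : Type v) [Group H] [Finite H] (f : H →* W), Function.Injective f →
      Nat.card H ∣ N := by
  refine ⟨Nat.card (Matrix k k (ZMod 3))ˣ, Nat.card_pos, fun H _ _ f hf => ?_⟩
  let φ : H →* (Matrix k k (ZMod 3))ˣ :=
    ((Int.castRingHom (ZMod 3)).mapMatrix.toMonoidHom.comp (ρ.comp f)).toHomUnits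
  refine Subgroup.card_dvd_of_injective φ ((MonoidHom.ker_eq_bot_iff φ).1 ?_)
  by_contra hker
  have h1 : Nat.card φ.ker ≠ 1 := fun h => hker (Subgroup.card_eq_one.1 h)
  have : Fact (Nat.card φ.ker).minFac.Prime := ⟨Nat.minFac_prime h1⟩
  -- By Cauchy, a nontrivial kernel of reduction mod 3 would contain an element of prime order.
  obtain ⟨⟨g, hg⟩, hgo⟩ := exists_prime_orderOf_dvd_card' (G := φ.ker) _ (Nat.minFac_dvd _)
  have h2 : g ^ (Nat.card φ.ker).minFac = 1 := by
    rw [← hgo]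
    exact congrArg Subtype.val (pow_orderOf_eq_one (⟨g, hg⟩ : φ.ker))
  have h3 : ρ (f g) = 1 := Matrix.eq_one_of_map_eq_one_of_pow_eq_one this.out
    (congrArg Units.val hg) (by rw [← map_pow, ← map_pow, h2, map_one, map_one])
  have h4 : g = 1 := hf (hρ (by rw [h3, map_one, map_one]))
  subst h4
  rw [show (⟨1, hg⟩ : φ.ker) = 1 from rfl, orderOf_one] at hgo
  exact this.out.one_lt.ne hgo

end IntegerMatrices

/-! ### The Euler weight under edge collapses -/

namespace GraphOfGroups

section Weights

variable {G : Type*} [Group G]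

lemma div_card_le (N : ℕ) (H : Subgroup G) : N / Nat.card G ≤ N / Nat.card H := by
  rw [← H.card_mul_index, ← Nat.div_div_eq_div_mul]
  exact Nat.div_le_self _ _

lemma two_mul_div_card_le (N : ℕ) {H : Subgroup G} (hH : H ≠ ⊤) :
    2 * (N / Nat.card G) ≤ N / Nat.card H := by
  rw [← H.card_mul_index, ← Nat.div_div_eq_div_mul]
  have h1 : H.index ≠ 1 := fun h => hH (Subgroup.index_eq_one.1 h)
  rcases Nat.eq_zero_or_pos H.index with h0 | h0
  · simp [h0]
  · calc 2 * (N / Nat.card H / H.index) ≤ H.index * (N / Nat.card H / H.index) :=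
          Nat.mul_le_mul_right _ (by omega)
      _ ≤ _ := Nat.mul_div_le _ _

omit [Group G] in
lemma div_card_of_infinite (N : ℕ) (h : Infinite G) : N / Nat.card G = 0 := by
  rw [Nat.card_eq_zero_of_infinite, Nat.div_zero]

end Weights

/-- The number of edges minus the number of vertices with finite group, weighted by the inverses
of the group orders and scaled by `N`. -/
noncomputable def eulerWeight (N : ℕ) (Λ : GraphOfGroups.{u, v}) [Fintype Λ.V] [Fintype Λ.E] : ℤ :=
  ∑ e, ((N / Nat.card (Λ.edgeGroup e) : ℕ) : ℤ) - ∑ a, ((N / Nat.card (Λ.G a) : ℕ) : ℤ)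

open scoped Classical in
/-- The number of vertices with infinite group. -/
noncomputable def infiniteVertices (Λ : GraphOfGroups.{u, v}) [Fintype Λ.V] : ℤ :=
  ∑ a, if Infinite (Λ.G a) then 1 else 0

lemma infiniteVertices_nonneg (Λ : GraphOfGroups.{u, v}) [Fintype Λ.V] :
    0 ≤ Λ.infiniteVertices :=
  Finset.sum_nonneg fun a _ => by split_ifs <;> norm_num

namespace EdgeCollapse

variable {Λ' Λ : GraphOfGroups.{u, v}} {e : Λ'.E} (C : EdgeCollapse Λ' e Λ)

/-- The edges of the original graph: the collapsed one, and those of the collapsed graph. -/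
noncomputable def optionEdgeEquiv : Option Λ.E ≃ Λ'.E := by
  classical
  exact (Equiv.optionCongr C.σ).trans (Equiv.optionSubtypeNe e)

include C in
lemma finite_edges (h : Finite Λ.E) : Finite Λ'.E := Finite.of_equiv _ C.optionEdgeEquiv

include C in
lemma finite_edges' (h : Finite Λ'.E) : Finite Λ.E :=
  Finite.of_injective (fun f => (C.σ f).1) (Subtype.val_injective.comp C.σ.injective)

include C in
lemma finite_vertices (h : Finite Λ.V) : Finite Λ'.V := by
  -- A fibre of `q` has at most two points, and being the initial vertex of `e` tells them apart.
  refine Finite.of_injective (β := Λ.V × Prop) (fun a => (C.q a, a = Λ'.src e)) fun a b hab => ?_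
  have h1 : C.q a = C.q b := congrArg Prod.fst hab
  have h2 : (a = Λ'.src e) = (b = Λ'.src e) := congrArg Prod.snd hab
  rcases (C.q_eq_iff a b).1 h1 with h | ⟨h, -⟩ | ⟨-, h⟩
  · exact h
  · exact h.trans (h2.mp h).symm
  · exact (h2.mpr h).trans h.symm

include C in
lemma finite_vertices' (h : Finite Λ'.V) : Finite Λ.V := Finite.of_surjective _ C.q_surjective

include C in
lemma card_edges [Fintype Λ.E] [Fintype Λ'.E] :
    Fintype.card Λ'.E = Fintype.card Λ.E + 1 := by
  rw [← Fintype.card_congr C.optionEdgeEquiv, Fintype.card_option]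

lemma sum_edges [Fintype Λ.E] [Fintype Λ'.E] {M : Type*} [AddCommMonoid M] (h : Λ'.E → M) :
    ∑ f, h f = h e + ∑ f, h (C.σ f) := by
  classical
  rw [Fintype.sum_eq_add_sum_subtype_ne h e, ← C.σ.sum_comp]

open scoped Classical in
lemma sum_vertices [Fintype Λ.V] [Fintype Λ'.V] {M : Type*} [AddCommGroup M] (h' : Λ'.V → M)
    (h : Λ.V → M) (hh : ∀ a, a ≠ Λ'.src e → a ≠ Λ'.tgt e → h' a = h (C.q a)) :
    ∑ a, h' a - ∑ b, h b = h' (Λ'.src e) + (if Λ'.src e = Λ'.tgt e then 0 else h' (Λ'.tgt e)) -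
      h (C.q (Λ'.src e)) := by
  rw [← Finset.sum_fiberwise Finset.univ C.q h', ← Finset.sum_sub_distrib,
    Fintype.sum_eq_single (C.q (Λ'.src e))]
  · congr 1
    have : ({a | C.q a = C.q (Λ'.src e)} : Finset Λ'.V) = {Λ'.src e, Λ'.tgt e} := by
      ext a
      simp only [Finset.mem_filter, Finset.mem_univ, true_and, Finset.mem_insert,
        Finset.mem_singleton]
      refine ⟨C.eq_or_eq_of_q_eq, ?_⟩
      rintro (rfl | rfl)
      exacts [rfl, C.q_src_eq_q_tgt.symm]
    rw [this]
    split_ifs with hst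
    · rw [← hst]; simp
    · rw [Finset.sum_pair hst]
  · intro b hb
    obtain ⟨a, rfl⟩ := C.q_surjective b
    have ha : a ≠ Λ'.src e := fun h => hb (by rw [h])
    have ha' : a ≠ Λ'.tgt e := fun h => hb (by rw [h, C.q_src_eq_q_tgt])
    have : ({a' | C.q a' = C.q a} : Finset Λ'.V) = {a} := by
      ext a'
      simp only [Finset.mem_filter, Finset.mem_univ, true_and, Finset.mem_singleton]
      refine ⟨fun h => ?_, fun h => by rw [h]⟩
      rcases (C.q_eq_iff _ _).1 h with h | ⟨-, h⟩ | ⟨-, h⟩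
      exacts [h, absurd h ha', absurd h ha]
    rw [this, Finset.sum_singleton, hh a ha ha', sub_self]

lemma eq_top_of_forall_mem {K : Subgroup (Λ.G (C.q (Λ'.src e)))}
    (h : ∀ (a) (h : C.q a = C.q (Λ'.src e)) (g : Λ'.G a), C.φ a _ h g ∈ K)
    (h' : C.edgeElement ∈ K) : K = ⊤ := by
  have key : K.comap C.θ.toMonoidHom = ⊤ := by
    rw [eq_top_iff, ← PresentedGroup.closure_range_of, Subgroup.closure_le]
    rintro _ ⟨⟨a, g⟩ | ⟨⟩, rfl⟩
    · have ha : C.q a.1 = C.q (Λ'.src e) := by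
        rcases a with ⟨a, rfl | rfl⟩
        exacts [rfl, C.q_src_eq_q_tgt.symm]
      have h1 := h a.1 ha g
      rw [← C.θ_ofVertex a ha g] at h1
      exact h1
    · exact h'
  rw [eq_top_iff]
  intro y _
  obtain ⟨x, rfl⟩ := C.θ.surjective y
  have : x ∈ K.comap C.θ.toMonoidHom := by rw [key]; trivial
  exact this

variable {W : Type w} [Group W] {r : Λ.Rep W}

lemma φ_injective (hr : Rep.IsUniversal.{u, v, _, max u v} r) {a : Λ'.V} {b : Λ.V}
    (h : C.q a = b) : Function.Injective (C.φ a b h) := by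
  subst h
  exact Function.Injective.of_comp ((C.isUniversal_pull hr).injective a)

lemma nonempty_edgeGroup_equiv (hr : Rep.IsUniversal.{u, v, _, max u v} r) (f : Λ.E) :
    Nonempty (Λ'.edgeGroup (C.σ f) ≃ Λ.edgeGroup f) := by
  have hinj : Function.Injective
      ((MulAut.conj (C.c f)).toMonoidHom.comp (C.φ _ _ (C.src_eq f))) :=
    (MulAut.conj (C.c f)).injective.comp (C.φ_injective hr _)
  rw [C.edgeGroup_eq f]
  exact ⟨(Subgroup.equivMapOfInjective _ _ hinj).toEquiv⟩

open scoped Classical in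
lemma eulerWeight_sub (hr : Rep.IsUniversal.{u, v, _, max u v} r)
    [Fintype Λ.V] [Fintype Λ.E] [Fintype Λ'.V] [Fintype Λ'.E] (N : ℕ) :
    Λ'.eulerWeight N - Λ.eulerWeight N = (N / Nat.card (Λ'.edgeGroup e) : ℕ) -
      (N / Nat.card (Λ'.G (Λ'.src e)) : ℕ) -
      (if Λ'.src e = Λ'.tgt e then 0 else (N / Nat.card (Λ'.G (Λ'.tgt e)) : ℕ)) +
      (N / Nat.card (Λ.G (C.q (Λ'.src e))) : ℕ) := by
  have h1 := C.sum_vertices (fun a => ((N / Nat.card (Λ'.G a) : ℕ) : ℤ))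
    (fun b => ((N / Nat.card (Λ.G b) : ℕ) : ℤ)) (fun a ha ha' => by
      rw [Nat.card_congr (Equiv.ofBijective _ (C.φ_bijective a _ rfl ha ha'))])
  have h2 := C.sum_edges fun f => ((N / Nat.card (Λ'.edgeGroup f) : ℕ) : ℤ)
  have h3 : ∀ f, Nat.card (Λ'.edgeGroup (C.σ f)) = Nat.card (Λ.edgeGroup f) :=
    fun f => Nat.card_congr (C.nonempty_edgeGroup_equiv hr f).some
  simp only [h3] at h2
  simp only [eulerWeight]
  push_cast at h1 h2 ⊢
  linarith

open scoped Classical in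
lemma infiniteVertices_sub [Fintype Λ.V] [Fintype Λ'.V] :
    Λ'.infiniteVertices - Λ.infiniteVertices = (if Infinite (Λ'.G (Λ'.src e)) then 1 else 0) +
      (if Λ'.src e = Λ'.tgt e then 0 else if Infinite (Λ'.G (Λ'.tgt e)) then 1 else 0) -
      (if Infinite (Λ.G (C.q (Λ'.src e))) then 1 else 0) :=
  C.sum_vertices _ _ fun a ha ha' => by
    rw [(Equiv.ofBijective _ (C.φ_bijective a _ rfl ha ha')).infinite_iff]

-- Write C, A, B, D for the edge group, the groups of its ends and the collapsed vertex group. The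
-- change of weight is wC - wA - wB + wD, without wB for a loop. For a non-loop that is not
-- reducible, wA and wB are at most wC/2. So the weight never drops, and it can stay equal only if D
-- is infinite while the end groups are finite; then an infinite vertex disappears.
include C in
theorem eulerWeight_lt_or (hr : Rep.IsUniversal.{u, v, _, max u v} r)
    [Fintype Λ.V] [Fintype Λ.E] [Fintype Λ'.V] [Fintype Λ'.E] {N : ℕ} (hN : 0 < N)
    (hdvd : ∀ (H : Type v) [Group H] [Finite H] (f : H →* W), Function.Injective f →
      Nat.card H ∣ N)
    (hfin : Finite (Λ'.edgeGroup e)) (he : ¬ Λ'.IsReducibleEdge e) :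
    Λ.eulerWeight N < Λ'.eulerWeight N ∨ (Λ.eulerWeight N ≤ Λ'.eulerWeight N ∧
      Λ'.infiniteVertices < Λ.infiniteVertices) := by
  classical
  have h1 := C.eulerWeight_sub hr N
  have h2 := C.infiniteVertices_sub
  have hr' := C.isUniversal_pull hr
  have hpos : ∀ (H : Type v) [Group H] (f : H →* W), Function.Injective f → Finite H →
      0 < N / Nat.card H := fun H _ f hf _ =>
    Nat.div_pos (Nat.le_of_dvd hN (hdvd H f hf)) Nat.card_pos
  have hC := hpos (Λ'.edgeGroup e) ((C.pull r).hom _ |>.comp (Λ'.edgeGroup e).subtype)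
    ((hr'.injective _).comp (Subgroup.subtype_injective _)) hfin
  have hD := hpos _ (r.hom (C.q (Λ'.src e))) (hr.injective _)
  have hA0 := div_card_of_infinite (G := Λ'.G (Λ'.src e)) N
  have hB0 := div_card_of_infinite (G := Λ'.G (Λ'.tgt e)) N
  have hA1 := div_card_le N (Λ'.edgeGroup e)
  have hDcases := finite_or_infinite (Λ.G (C.q (Λ'.src e)))
  by_cases hst : Λ'.src e = Λ'.tgt e
  · simp only [if_pos hst] at h1 h2
    generalize N / Nat.card (Λ.G (C.q (Λ'.src e))) = wD at *
    generalize N / Nat.card (Λ'.G (Λ'.src e)) = wA at *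
    generalize N / Nat.card (Λ'.edgeGroup e) = wC at *
    rcases hDcases with hDf | hDi
    · left
      have := hD hDf
      omega
    · rw [if_pos hDi] at h2
      by_cases hA : Infinite (Λ'.G (Λ'.src e))
      · left
        have := hA0 hA
        omega
      · right
        rw [if_neg hA] at h2
        omega
  · simp only [if_neg hst] at h1 h2
    have hA2 : 2 * (N / Nat.card (Λ'.G (Λ'.src e))) ≤ N / Nat.card (Λ'.edgeGroup e) :=
      two_mul_div_card_le N fun h => he ⟨hst, Or.inl h⟩
    have hB2 : 2 * (N / Nat.card (Λ'.G (Λ'.tgt e))) ≤ N / Nat.card (Λ'.edgeGroup e) := by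
      rw [Nat.card_congr (MonoidHom.ofInjective (Λ'.edgeMap_injective e)).toEquiv]
      exact two_mul_div_card_le N fun h => he ⟨hst, Or.inr (MonoidHom.range_eq_top.1 h)⟩
    generalize N / Nat.card (Λ.G (C.q (Λ'.src e))) = wD at *
    generalize N / Nat.card (Λ'.G (Λ'.src e)) = wA at *
    generalize N / Nat.card (Λ'.G (Λ'.tgt e)) = wB at *
    generalize N / Nat.card (Λ'.edgeGroup e) = wC at *
    rcases hDcases with hDf | hDi
    · left
      have := hD hDf
      omega
    · rw [if_pos hDi] at h2
      by_cases hA : Infinite (Λ'.G (Λ'.src e))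
      · left
        have := hA0 hA
        omega
      · by_cases hB : Infinite (Λ'.G (Λ'.tgt e))
        · left
          have := hB0 hB
          omega
        · right
          rw [if_neg hA, if_neg hB] at h2
          omega

-- The amalgam of B with A = C over C is B, so wA cancels wC and wB cancels wD. The group A is
-- finite, so no infinite vertex is lost.
include C in
theorem eulerWeight_eq_of_isReducibleEdge (hr : Rep.IsUniversal.{u, v, _, max u v} r)
    [Fintype Λ.V] [Fintype Λ.E] [Fintype Λ'.V] [Fintype Λ'.E] (N : ℕ)
    (hfin : Finite (Λ'.edgeGroup e)) (he : Λ'.IsReducibleEdge e) :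
    Λ.eulerWeight N = Λ'.eulerWeight N ∧ Λ.infiniteVertices = Λ'.infiniteVertices := by
  classical
  have h1 := C.eulerWeight_sub hr N
  have h2 := C.infiniteVertices_sub
  obtain ⟨hst, he⟩ := he
  simp only [if_neg hst] at h1 h2
  have hrel : ∀ g : Λ'.edgeGroup e, C.φ (Λ'.src e) _ rfl g =
      C.φ (Λ'.tgt e) _ C.q_src_eq_q_tgt.symm (Λ'.edgeMap e g) := by
    simpa [C.edgeElement_eq_one hst] using C.φ_mul_edgeElement
  rcases he with he | he
  · let α : Λ'.edgeGroup e ≃ Λ'.G (Λ'.src e) := Equiv.ofBijective Subtype.val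
      ⟨Subtype.val_injective, fun g => ⟨⟨g, he ▸ Subgroup.mem_top g⟩, rfl⟩⟩
    have hsurj : Function.Surjective (C.φ (Λ'.tgt e) _ C.q_src_eq_q_tgt.symm) := by
      refine MonoidHom.range_eq_top.1 (C.eq_top_of_forall_mem (fun a h g => ?_) ?_)
      · rcases C.eq_or_eq_of_q_eq h with rfl | rfl
        · obtain ⟨g, rfl⟩ := α.surjective g
          exact ⟨_, (hrel g).symm⟩
        · exact ⟨g, rfl⟩
      · rw [C.edgeElement_eq_one hst]
        exact one_mem _
    have β := Equiv.ofBijective _ ⟨C.φ_injective hr C.q_src_eq_q_tgt.symm, hsurj⟩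
    have hA : ¬ Infinite (Λ'.G (Λ'.src e)) := not_infinite_iff_finite.2 (Finite.of_equiv _ α)
    rw [Nat.card_congr α, Nat.card_congr β] at h1
    rw [β.infinite_iff, if_neg hA] at h2
    constructor <;> omega
  · let α : Λ'.edgeGroup e ≃ Λ'.G (Λ'.tgt e) := Equiv.ofBijective _
      ⟨Λ'.edgeMap_injective e, he⟩
    have hsurj : Function.Surjective (C.φ (Λ'.src e) _ rfl) := by
      refine MonoidHom.range_eq_top.1 (C.eq_top_of_forall_mem (fun a h g => ?_) ?_)
      · rcases C.eq_or_eq_of_q_eq h with rfl | rfl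
        · exact ⟨g, rfl⟩
        · obtain ⟨g, rfl⟩ := α.surjective g
          exact ⟨_, hrel g⟩
      · rw [C.edgeElement_eq_one hst]
        exact one_mem _
    have β := Equiv.ofBijective _ ⟨C.φ_injective hr rfl, hsurj⟩
    have hB : ¬ Infinite (Λ'.G (Λ'.tgt e)) := not_infinite_iff_finite.2 (Finite.of_equiv _ α)
    rw [Nat.card_congr α, Nat.card_congr β] at h1
    rw [β.infinite_iff, if_neg hB] at h2
    constructor <;> omega

end EdgeCollapse

/-! ### The upper bound for the Euler weight -/

lemma card_le_card_range {G Q : Type*} [Group G] [Group Q] [Finite Q] (f : G →* Q) (T : Finset G)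
    (hT : Set.InjOn f T) : T.card ≤ Nat.card f.range := by
  have := Nat.card_le_card_of_injective (fun t : T => (⟨f t, t, rfl⟩ : f.range))
    fun s t hst => Subtype.ext (hT s.2 t.2 (congrArg Subtype.val hst))
  simpa using this

theorem Rep.IsUniversal.eulerWeight_le {Λ : GraphOfGroups.{u, v}} {W : Type w} [Group W]
    {r : Λ.Rep W} (hr : Rep.IsUniversal.{u, v, _, max u v} r)
    [Fintype Λ.V] [Fintype Λ.E] (hfin : ∀ e, Finite (Λ.edgeGroup e)) {N : ℕ}
    (hdvd : ∀ (H : Type v) [Group H] [Finite H] (f : H →* W), Function.Injective f →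
      Nat.card H ∣ N)
    (hres : ∀ S : Finset W, ∃ (Q : Type (max u v)) (_ : Group Q) (_ : Finite Q) (ψ : W →* Q),
      Set.InjOn ψ S)
    (S : Finset W) (hS : Subgroup.closure (S : Set W) = ⊤) :
    Λ.eulerWeight N ≤ N * (S.card + 1) := by
  classical
  -- The finite quotient is to be injective on finite vertex groups and to give infinite ones an
  -- image of order at least |V|, so that the latter contribute at most 1 in total.
  have hT : ∀ a, ∃ T : Finset (Λ.G a), (Finite (Λ.G a) → T.card = Nat.card (Λ.G a)) ∧
      (Infinite (Λ.G a) → T.card = Fintype.card Λ.V) := by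
    intro a
    rcases finite_or_infinite (Λ.G a) with h | h
    · have := Fintype.ofFinite (Λ.G a)
      exact ⟨Finset.univ, fun _ => by simp, fun h' => absurd h (not_finite_iff_infinite.2 h')⟩
    · obtain ⟨T, hT⟩ := Infinite.exists_subset_card_eq (Λ.G a) (Fintype.card Λ.V)
      exact ⟨T, fun h' => absurd h' (not_finite_iff_infinite.2 h), fun _ => hT⟩
  choose T hT hT' using hT
  obtain ⟨Q, _, _, ψ, hψ⟩ := hres (Finset.univ.biUnion fun a => (T a).image (r.hom a))
  have hrange : ∀ a, (T a).card ≤ Nat.card (ψ.comp (r.hom a)).range := fun a =>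
    card_le_card_range _ _ fun s hs t ht hst => hr.injective a (hψ
      (Finset.mem_biUnion.2 ⟨a, Finset.mem_univ _, Finset.mem_image_of_mem _ hs⟩)
      (Finset.mem_biUnion.2 ⟨a, Finset.mem_univ _, Finset.mem_image_of_mem _ ht⟩) hst)
  have hQ : (0 : ℚ) < Nat.card Q := by exact_mod_cast Nat.card_pos
  have hV : (0 : ℚ) < Fintype.card Λ.V := by
    have := Λ.nonempty
    exact_mod_cast Fintype.card_pos
  have hidx : ∀ H : Subgroup Q, (H.index : ℚ) = Nat.card Q * (Nat.card H : ℚ)⁻¹ := fun H => by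
    have h : (Nat.card H : ℚ) ≠ 0 := by exact_mod_cast Nat.card_pos.ne'
    rw [← H.card_mul_index]
    push_cast
    field_simp
  have hle : (∑ e, ((((Λ.edgeGroup e).map (ψ.comp (r.hom (Λ.src e)))).index : ℕ) : ℚ)) ≤
      Nat.card Q * S.card + ∑ a, (((ψ.comp (r.hom a)).range.index : ℕ) : ℚ) := by
    exact_mod_cast hr.sum_index_le ψ S hS
  simp only [hidx, ← Finset.mul_sum, ← mul_add] at hle
  replace hle := le_of_mul_le_mul_left hle hQ
  have hE : ∀ e, (Nat.card (Λ.edgeGroup e) : ℚ)⁻¹ ≤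
      (Nat.card ((Λ.edgeGroup e).map (ψ.comp (r.hom (Λ.src e)))) : ℚ)⁻¹ := fun e => by
    have := hfin e
    refine inv_anti₀ (by exact_mod_cast Nat.card_pos) ?_
    exact_mod_cast Nat.card_le_card_of_surjective _
      ((ψ.comp (r.hom (Λ.src e))).subgroupMap_surjective (Λ.edgeGroup e))
  have hA : ∀ a, (Nat.card (ψ.comp (r.hom a)).range : ℚ)⁻¹ ≤
      (Nat.card (Λ.G a) : ℚ)⁻¹ + (Fintype.card Λ.V : ℚ)⁻¹ := fun a => by
    rcases finite_or_infinite (Λ.G a) with h | h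
    · refine le_add_of_le_of_nonneg (inv_anti₀ (by exact_mod_cast Nat.card_pos) ?_) (by positivity)
      exact_mod_cast hT a h ▸ hrange a
    · rw [Nat.card_eq_zero_of_infinite (α := Λ.G a), Nat.cast_zero, inv_zero, zero_add]
      exact inv_anti₀ hV (by exact_mod_cast hT' a h ▸ hrange a)
  have hsum : ∑ e, (Nat.card (Λ.edgeGroup e) : ℚ)⁻¹ ≤
      S.card + (∑ a, (Nat.card (Λ.G a) : ℚ)⁻¹ + 1) := by
    refine (Finset.sum_le_sum fun e _ => hE e).trans (hle.trans (add_le_add_right ?_ _))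
    refine (Finset.sum_le_sum fun a _ => hA a).trans (le_of_eq ?_)
    rw [Finset.sum_add_distrib, Finset.sum_const, Finset.card_univ, nsmul_eq_mul,
      mul_inv_cancel₀ hV.ne']
  have hdiv : ∀ (H : Type v) [Group H] (f : H →* W), Function.Injective f →
      ((N / Nat.card H : ℕ) : ℚ) = N * (Nat.card H : ℚ)⁻¹ := fun H _ f hf => by
    rcases finite_or_infinite H with h | h
    · rw [Nat.cast_div (hdvd H f hf) (by exact_mod_cast Nat.card_pos.ne'), div_eq_mul_inv]
    · simp
  have : (Λ.eulerWeight N : ℚ) ≤ N * (S.card + 1) := by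
    simp only [eulerWeight, Int.cast_sub, Int.cast_sum, Int.cast_natCast]
    rw [Finset.sum_congr rfl fun e _ => hdiv _ ((r.hom _).comp (Λ.edgeGroup e).subtype)
      ((hr.injective _).comp (Subgroup.subtype_injective _)),
      Finset.sum_congr rfl fun a _ => hdiv _ (r.hom a) (hr.injective _),
      ← Finset.mul_sum, ← Finset.mul_sum, ← mul_sub]
    refine mul_le_mul_of_nonneg_left ?_ (by positivity)
    linarith
  exact_mod_cast this

end GraphOfGroups

/-! ### Accessibility of groups of integer matrices -/

open GraphOfGroups in
/-- A finitely generated group of integer matrices is accessible. -/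
theorem isAccessible_of_injective {W : Type w} [Group W] (hW : Group.FG W) {k : Type} [Fintype k]
    [DecidableEq k] {ρ : W →* Matrix k k ℤ} (hρ : Function.Injective ρ) :
    IsAccessible.{u, v} W := by
  rintro ⟨Λ, ⟨T, hT, ⟨θ⟩⟩, hV, hE, hG, hstep⟩
  obtain ⟨S, hS⟩ := Group.fg_def.1 hW
  obtain ⟨N, hN, hdvd⟩ := exists_card_finite_dvd.{v} hρ
  have hres : ∀ S : Finset W, ∃ (Q : Type (max u v)) (_ : Group Q) (_ : Finite Q) (ψ : W →* Q),
      Set.InjOn ψ S := by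
    intro S
    obtain ⟨m, _, ψ, hψ⟩ := exists_finite_quotient_injOn hρ S
    exact ⟨ULift (Matrix k k (ZMod m))ˣ, inferInstance, inferInstance,
      MulEquiv.ulift.symm.toMonoidHom.comp ψ, MulEquiv.ulift.symm.injective.comp_injOn hψ⟩
  have hall : ∀ n, Finite (Λ n).V ∧ Finite (Λ n).E ∧ (∀ e, Finite ((Λ n).edgeGroup e)) ∧
      ∃ r : (Λ n).Rep W, Rep.IsUniversal.{u, v, _, max u v} r := by
    intro n
    induction n with
    | zero =>
      exact ⟨hV, hE, hG, _, ((Λ 0).isUniversal_canonicalRep T hT).map_equiv θ⟩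
    | succ n ih =>
      obtain ⟨hV, hE, hG, r, hr⟩ := ih
      rcases hstep n with ⟨e, hfin, -, ⟨C⟩⟩ | ⟨e, -, ⟨C⟩⟩
      · refine ⟨C.finite_vertices hV, C.finite_edges hE, fun f => ?_, _, C.isUniversal_pull hr⟩
        rcases C.edge_cases f with rfl | ⟨f, rfl⟩
        · exact hfin
        · have := hG f
          exact Finite.of_equiv _ (C.nonempty_edgeGroup_equiv hr f).some.symm
      · obtain ⟨r', hr'⟩ := C.exists_isUniversal hr
        refine ⟨C.finite_vertices' hV, C.finite_edges' hE, fun f => ?_, r', hr'⟩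
        have := hG (C.σ f)
        exact Finite.of_equiv _ (C.nonempty_edgeGroup_equiv hr' f).some
  have : ∀ n, Fintype (Λ n).V := fun n => @Fintype.ofFinite _ (hall n).1
  have : ∀ n, Fintype (Λ n).E := fun n => @Fintype.ofFinite _ (hall n).2.1
  have hbound : ∀ n, (Λ n).eulerWeight N ≤ N * (S.card + 1) := fun n => by
    obtain ⟨-, -, hG, r, hr⟩ := hall n
    exact hr.eulerWeight_le hG hdvd hres S hS
  -- Lexicographic descent: distance of the weight to its bound, then infinite vertices, then edges.
  -- The truncations `toNat` lose nothing, as the numbers are nonnegative.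
  refine not_strictAnti_of_wellFoundedLT (fun n => toLex
    ((N * (S.card + 1) - (Λ n).eulerWeight N).toNat,
      toLex ((Λ n).infiniteVertices.toNat, Fintype.card (Λ n).E)))
    (strictAnti_nat_of_succ_lt fun n => ?_)
  have h0 := hbound n
  have h1 := hbound (n + 1)
  have h2 := (Λ n).infiniteVertices_nonneg
  have h3 := (Λ (n + 1)).infiniteVertices_nonneg
  simp only [Prod.Lex.toLex_lt_toLex]
  rcases hstep n with ⟨e, hfin, he, ⟨C⟩⟩ | ⟨e, he, ⟨C⟩⟩
  · obtain ⟨-, -, -, r, hr⟩ := hall n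
    have := C.eulerWeight_lt_or hr hN hdvd hfin he
    omega
  · obtain ⟨-, -, -, r, hr⟩ := hall (n + 1)
    have h4 := C.eulerWeight_eq_of_isReducibleEdge hr N ((hall n).2.2.1 e) he
    have h5 := C.card_edges
    rw [h4.1, h4.2]
    omega

/-! ### Ratios of sines -/

/-- The ratio `sin (n φ) / sin φ` as a polynomial in `a = 2 cos φ`. -/
def sinRatio (a : ℝ) : ℕ → ℝ
  | 0 => 0
  | 1 => 1
  | n + 2 => a * sinRatio a (n + 1) - sinRatio a n

lemma sinRatio_mul_sin (φ : ℝ) (n : ℕ) :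
    sinRatio (2 * Real.cos φ) n * Real.sin φ = Real.sin (n * φ) := by
  induction n using Nat.twoStepInduction with
  | zero => simp [sinRatio]
  | one => simp [sinRatio]
  | more n h1 h2 =>
    rw [sinRatio, sub_mul, mul_assoc, h1, h2]
    have h3 : ((n + 2 : ℕ) : ℝ) * φ = (n + 1 : ℕ) * φ + φ := by push_cast; ring
    have h4 : (n : ℝ) * φ = (n + 1 : ℕ) * φ - φ := by push_cast; ring
    rw [h3, h4, Real.sin_add, Real.sin_sub]
    ring

lemma sinRatio_two (n : ℕ) : sinRatio 2 n = n := by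
  induction n using Nat.twoStepInduction with
  | zero => simp [sinRatio]
  | one => simp [sinRatio]
  | more n h1 h2 =>
    rw [sinRatio, h1, h2]
    push_cast
    ring

lemma sin_pi_div_pos {m : ℕ} (hm : 2 ≤ m) : 0 < Real.sin (Real.pi / m) := by
  have : (2 : ℝ) ≤ m := by exact_mod_cast hm
  refine Real.sin_pos_of_pos_of_lt_pi (by positivity) ?_
  rw [div_lt_iff₀ (by linarith)]
  nlinarith [Real.pi_pos]

lemma sinRatio_nonneg {m n : ℕ} (hm : m ≠ 1) (hn : m ≠ 0 → n ≤ m) :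
    0 ≤ sinRatio (2 * Real.cos (Real.pi / m)) n := by
  rcases Nat.eq_zero_or_pos m with rfl | h0
  -- The value m = 0 encodes an infinite order; division by zero gives the angle 0, hence a = 2.
  · simp [sinRatio_two]
  · have h1 := sin_pi_div_pos (m := m) (by omega)
    refine nonneg_of_mul_nonneg_left (b := Real.sin (Real.pi / m)) ?_ h1
    rw [sinRatio_mul_sin]
    have hm' : (0 : ℝ) < m := by exact_mod_cast h0
    have hn' : (n : ℝ) ≤ m := by exact_mod_cast hn h0.ne'
    refine Real.sin_nonneg_of_nonneg_of_le_pi (by positivity) ?_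
    rw [mul_div_assoc', div_le_iff₀ hm', mul_comm]
    exact mul_le_mul_of_nonneg_left hn' Real.pi_pos.le

/-! ### The geometric representation -/

namespace CoxeterMatrix

variable {B : Type*} (M : CoxeterMatrix B)

/-- Minus twice the entry of the cosine matrix. -/
noncomputable def cosEntry (i j : B) : ℝ := 2 * Real.cos (Real.pi / M i j)

lemma cosEntry_symm (i j : B) : M.cosEntry i j = M.cosEntry j i := by
  rw [cosEntry, cosEntry, M.symmetric]

lemma cosEntry_self (i : B) : M.cosEntry i i = -2 := by
  simp [cosEntry]

/-- The linear form that belongs to a simple reflection. -/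
noncomputable def coroot (i : B) : (B →₀ ℝ) →ₗ[ℝ] ℝ :=
  Finsupp.linearCombination ℝ fun j => M.cosEntry i j

/-- A simple root. -/
noncomputable abbrev root (i : B) : B →₀ ℝ := Finsupp.single i 1

/-- The simple reflections of the geometric representation. -/
noncomputable def geomReflection (i : B) : Module.End ℝ (B →₀ ℝ) :=
  LinearMap.id + (M.coroot i).smulRight (root i)

lemma coroot_single (i j : B) (x : ℝ) :
    M.coroot i (Finsupp.single j x) = x * M.cosEntry i j := by
  simp [coroot]

lemma geomReflection_apply (i : B) (v : B →₀ ℝ) :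
    M.geomReflection i v = v + M.coroot i v • root i := by
  simp [geomReflection]

lemma geomReflection_root (i j : B) :
    M.geomReflection i (root j) = root j + M.cosEntry i j • root i := by
  rw [geomReflection_apply, coroot_single, one_mul]

lemma geomReflection_root_self (i : B) : M.geomReflection i (root i) = -root i := by
  rw [geomReflection_root, cosEntry_self]
  module

lemma geomReflection_mul_self (i : B) : M.geomReflection i * M.geomReflection i = 1 := by
  refine LinearMap.ext fun v => ?_
  rw [Module.End.mul_apply, Module.End.one_apply, M.geomReflection_apply i v, map_add, map_smul,
    geomReflection_root_self, geomReflection_apply]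
  module

lemma geomReflection_mul_pow_root (i j : B) (k : ℕ) :
    ((M.geomReflection i * M.geomReflection j) ^ k) (root i) =
      sinRatio (M.cosEntry i j) (2 * k + 1) • root i +
        sinRatio (M.cosEntry i j) (2 * k) • root j := by
  induction k with
  | zero => simp [sinRatio]
  | succ k ih =>
    rw [pow_succ', Module.End.mul_apply, ih, Module.End.mul_apply]
    simp only [map_add, map_smul, geomReflection_root, cosEntry_self]
    rw [M.cosEntry_symm j i, show 2 * (k + 1) + 1 = (2 * k + 1) + 2 by ring,
      show 2 * (k + 1) = 2 * k + 2 by ring, sinRatio, sinRatio]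
    module

lemma geomReflection_pow_root {i j : B} (hij : i ≠ j) :
    ((M.geomReflection i * M.geomReflection j) ^ M i j) (root i) = root i := by
  rcases Nat.eq_zero_or_pos (M i j) with h0 | h0
  · simp [h0]
  · have h1 := M.off_diagonal i j hij
    have h2 := sin_pi_div_pos (m := M i j) (by omega)
    have h3 : (M i j : ℝ) ≠ 0 := by exact_mod_cast h0.ne'
    rw [geomReflection_mul_pow_root]
    have h4 : sinRatio (M.cosEntry i j) (2 * M i j + 1) = 1 := by
      refine mul_right_cancel₀ h2.ne' ?_
      rw [cosEntry, sinRatio_mul_sin, one_mul]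
      rw [show ((2 * M i j + 1 : ℕ) : ℝ) * (Real.pi / M i j) =
        Real.pi / M i j + 2 * Real.pi by push_cast; field_simp; ring, Real.sin_add_two_pi]
    have h5 : sinRatio (M.cosEntry i j) (2 * M i j) = 0 := by
      refine mul_right_cancel₀ h2.ne' ?_
      rw [cosEntry, sinRatio_mul_sin, zero_mul]
      rw [show ((2 * M i j : ℕ) : ℝ) * (Real.pi / M i j) = 2 * Real.pi by
        push_cast; field_simp, Real.sin_two_pi]
    rw [h4, h5, one_smul, zero_smul, add_zero]

lemma geomReflection_pow_root' {i j : B} (hij : i ≠ j) :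
    ((M.geomReflection i * M.geomReflection j) ^ M i j) (root j) = root j := by
  have h1 := M.geomReflection_pow_root hij.symm
  rw [M.symmetric j i] at h1
  have h2 : ∀ i j, M.geomReflection i * M.geomReflection j *
      (M.geomReflection j * M.geomReflection i) = 1 := fun i j => by
    rw [mul_assoc, ← mul_assoc (M.geomReflection j), geomReflection_mul_self, one_mul,
      geomReflection_mul_self]
  have h3 : Commute (M.geomReflection i * M.geomReflection j)
      (M.geomReflection j * M.geomReflection i) := by
    rw [Commute, SemiconjBy, h2, h2]
  nth_rewrite 1 [← h1]
  rw [← Module.End.mul_apply, ← h3.mul_pow, h2, one_pow, Module.End.one_apply]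

/-- For finite m the form on the plane of the two roots is nondegenerate, as 4 - a² = 4 sin²(π/m).
Hence the space is this plane plus the common kernel of the two coroots, on which both reflections
are trivial. -/
lemma isLiftable_geomReflection : M.IsLiftable M.geomReflection := by
  intro i j
  by_cases hij : i = j
  · subst hij
    rw [geomReflection_mul_self, one_pow]
  rcases Nat.eq_zero_or_pos (M i j) with h0 | h0
  · rw [h0, pow_zero]
  have h1 := M.off_diagonal i j hij
  have h2 := sin_pi_div_pos (m := M i j) (by omega)
  have h3 : 4 - M.cosEntry i j ^ 2 ≠ 0 := by
    have : 4 - M.cosEntry i j ^ 2 = 4 * Real.sin (Real.pi / M i j) ^ 2 := by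
      rw [cosEntry, Real.sin_sq]; ring
    rw [this]
    positivity
  refine LinearMap.ext fun v => ?_
  let a := M.cosEntry i j
  -- Cramer's rule for the condition that both coroots vanish on `v - x α_i - y α_j`.
  let x := -(2 * M.coroot i v + a * M.coroot j v) / (4 - a ^ 2)
  let y := -(a * M.coroot i v + 2 * M.coroot j v) / (4 - a ^ 2)
  obtain ⟨v₀, hv₀⟩ : ∃ v₀, v₀ = v - x • root i - y • root j := ⟨_, rfl⟩
  have hi : M.coroot i v₀ = 0 := by
    rw [hv₀]
    simp only [map_sub, map_smul, coroot_single, cosEntry_self, smul_eq_mul, x, y, a]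
    field_simp
    ring
  have hj : M.coroot j v₀ = 0 := by
    rw [hv₀]
    simp only [map_sub, map_smul, coroot_single, cosEntry_self, smul_eq_mul, x, y, a,
      M.cosEntry_symm j i]
    field_simp
    ring
  have hfix : ∀ k : ℕ, ((M.geomReflection i * M.geomReflection j) ^ k) v₀ = v₀ := by
    intro k
    induction k with
    | zero => simp
    | succ k ih =>
      rw [pow_succ', Module.End.mul_apply, ih, Module.End.mul_apply, geomReflection_apply _ j, hj,
        zero_smul, add_zero, geomReflection_apply, hi, zero_smul, add_zero]
  have hv : v = v₀ + x • root i + y • root j := by rw [hv₀]; abel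
  rw [hv, map_add, map_add, map_smul, map_smul, hfix, M.geomReflection_pow_root hij,
    M.geomReflection_pow_root' hij, Module.End.one_apply]

end CoxeterMatrix

/-! ### Faithfulness and the integral form -/

namespace CoxeterSystem

open CoxeterMatrix

variable {B W : Type*} [Group W] {M : CoxeterMatrix B} (cs : CoxeterSystem M W)

/-- The geometric representation of a Coxeter group. -/
noncomputable def geomRep : W →* Module.End ℝ (B →₀ ℝ) :=
  cs.lift ⟨M.geomReflection, M.isLiftable_geomReflection⟩

lemma geomRep_simple (i : B) : cs.geomRep (cs.simple i) = M.geomReflection i :=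
  cs.lift_apply_simple _ i

lemma geomRep_alternatingWord (i j : B) (k : ℕ) :
    cs.geomRep (cs.wordProd (alternatingWord i j k)) (root i) =
      if Even k then sinRatio (M.cosEntry i j) (k + 1) • root i +
        sinRatio (M.cosEntry i j) k • root j
      else sinRatio (M.cosEntry i j) k • root i +
        sinRatio (M.cosEntry i j) (k + 1) • root j := by
  induction k with
  | zero => simp [sinRatio, alternatingWord]
  | succ k ih =>
    rw [alternatingWord_succ', wordProd_cons, map_mul, Module.End.mul_apply, ih, geomRep_simple]
    by_cases hk : Even k
    · rw [if_pos hk, if_pos hk, if_neg (by simpa [Nat.even_add_one] using hk)]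
      simp only [map_add, map_smul, geomReflection_root, cosEntry_self]
      rw [sinRatio, M.cosEntry_symm j i]
      module
    · rw [if_neg hk, if_neg hk, if_pos (by simpa [Nat.even_add_one] using hk)]
      simp only [map_add, map_smul, geomReflection_root, cosEntry_self]
      rw [sinRatio]
      module

/-- Splitting off the longest right factor in a dihedral subgroup. -/
lemma exists_eq_mul_alternatingWord (n : ℕ) : ∀ (w : W) (i j : B), cs.length w = n →
    ¬ cs.IsRightDescent w i → ∃ (v : W) (k : ℕ), w = v * cs.wordProd (alternatingWord i j k) ∧
      cs.length w = cs.length v + k ∧ ¬ cs.IsRightDescent v i ∧ ¬ cs.IsRightDescent v j := by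
  induction n with
  | zero =>
    intro w i j hw hi
    refine ⟨w, 0, by simp [alternatingWord], rfl, hi, ?_⟩
    rw [cs.length_eq_zero_iff.1 hw]
    exact cs.not_isRightDescent_one j
  | succ n ih =>
    intro w i j hw hi
    by_cases hj : cs.IsRightDescent w j
    · have h1 := cs.isRightDescent_iff.1 hj
      obtain ⟨v, k, hv, hl, hvj, hvi⟩ := ih (w * cs.simple j) j i (by omega)
        (cs.isRightDescent_iff_not_isRightDescent_mul.1 hj)
      refine ⟨v, k + 1, ?_, by omega, hvi, hvj⟩
      rw [alternatingWord_succ, wordProd_concat, ← mul_assoc, ← hv,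
        simple_mul_simple_cancel_right]
    · exact ⟨w, 0, by simp [alternatingWord], rfl, hi, hj⟩

/-- Roots are positive where the length increases. -/
theorem geomRep_root_nonneg (n : ℕ) : ∀ (w : W) (i : B), cs.length w = n →
    ¬ cs.IsRightDescent w i → 0 ≤ cs.geomRep w (root i) := by
  induction n using Nat.strong_induction_on with
  | _ n ih =>
    intro w i hw hi
    by_cases h1 : w = 1
    · rw [h1, map_one, Module.End.one_apply]
      exact Finsupp.single_nonneg.2 zero_le_one
    obtain ⟨j, hj⟩ := cs.exists_rightDescent_of_ne_one h1
    have hij : i ≠ j := fun h => hi (h ▸ hj)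
    obtain ⟨v, k, hv, hl, hvi, hvj⟩ := cs.exists_eq_mul_alternatingWord n w i j hw hi
    have hk : k ≠ 0 := by
      rintro rfl
      rw [hv] at hj
      simp only [alternatingWord, wordProd_nil, mul_one] at hj
      exact hvj hj
    -- Otherwise the alternating word of length k + 1 would not be reduced, and `w s_i` would be no
    -- longer than `w`. The bound k + 1 ≤ m makes both coefficients of the dihedral factor
    -- nonnegative.
    have hkm : M j i ≠ 0 → k + 1 ≤ M j i := by
      intro h0
      by_contra hlt
      refine cs.not_isReduced_alternatingWord j i h0 (m := k + 1) (by omega) ?_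
      have h2 := cs.not_isRightDescent_iff.1 hi
      have h3 : w * cs.simple i = v * cs.wordProd (alternatingWord j i (k + 1)) := by
        rw [alternatingWord_succ, wordProd_concat, ← mul_assoc, ← hv]
      have h4 := cs.length_mul_le v (cs.wordProd (alternatingWord j i (k + 1)))
      have h5 := cs.length_wordProd_le (alternatingWord j i (k + 1))
      rw [← h3] at h4
      rw [length_alternatingWord] at h5
      rw [IsReduced, length_alternatingWord]
      omega
    rw [M.symmetric] at hkm
    have h6 := ih _ (by omega) v i rfl hvi
    have h7 := ih _ (by omega) v j rfl hvj
    have h8 : 0 ≤ sinRatio (M.cosEntry i j) k :=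
      sinRatio_nonneg (M.off_diagonal i j hij) fun h => (Nat.le_succ k).trans (hkm h)
    have h9 : 0 ≤ sinRatio (M.cosEntry i j) (k + 1) :=
      sinRatio_nonneg (M.off_diagonal i j hij) hkm
    rw [hv, map_mul, Module.End.mul_apply, geomRep_alternatingWord]
    split_ifs <;> rw [map_add, map_smul, map_smul] <;>
      exact add_nonneg (smul_nonneg (by assumption) h6) (smul_nonneg (by assumption) h7)

/-- If w ≠ 1 acts trivially and j is a right descent of w, then `w s_j` sends the root of j to its
negative, although its length increases on multiplication by s_j. -/
theorem geomRep_injective : Function.Injective cs.geomRep := by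
  have key : ∀ w, cs.geomRep w = 1 → w = 1 := by
    intro w hw
    by_contra h1
    obtain ⟨j, hj⟩ := cs.exists_rightDescent_of_ne_one h1
    have h2 := cs.geomRep_root_nonneg _ (w * cs.simple j) j rfl
      (cs.isRightDescent_iff_not_isRightDescent_mul.1 hj)
    rw [map_mul, hw, one_mul, geomRep_simple, geomReflection_root_self] at h2
    have h3 := h2 j
    simp at h3
    linarith
  intro w w' h
  rw [← inv_mul_eq_one]
  refine key _ ?_
  rw [map_mul, ← h, ← map_mul, inv_mul_cancel, map_one]

lemma geomRep_apply_eq_of_mem_closure {I : Set B} {j : B} (hj : j ∉ I) {w : W}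
    (hw : w ∈ Subgroup.closure (cs.simple '' I)) (v : B →₀ ℝ) : cs.geomRep w v j = v j := by
  have h1 : ∀ i ∈ I, ∀ v, M.geomReflection i v j = v j := fun i hi v => by
    have : i ≠ j := fun h => hj (h ▸ hi)
    simp [geomReflection_apply, this]
  induction hw using Subgroup.closure_induction generalizing v with
  | mem x hx =>
    obtain ⟨i, hi, rfl⟩ := hx
    rw [geomRep_simple, h1 i hi]
  | one => simp
  | mul x y _ _ hx hy => rw [map_mul, Module.End.mul_apply, hx, hy]
  | inv x _ hx =>
    rw [← hx, ← Module.End.mul_apply, ← map_mul, mul_inv_cancel, map_one, Module.End.one_apply]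

-- Finitely many generators involve a finite set I of simple reflections. The group they generate
-- fixes every coordinate outside I, whereas s_j negates the root of j.
include cs in
theorem finite_of_fg (hW : Group.FG W) : Finite B := by
  obtain ⟨S, hS⟩ := Group.fg_def.1 hW
  choose ω hω using cs.wordProd_surjective
  let I : Set B := ⋃ s ∈ S, {i | i ∈ ω s}
  have hI : I.Finite := S.finite_toSet.biUnion fun s _ => List.finite_toSet (ω s)
  have htop : Subgroup.closure (cs.simple '' I) = ⊤ := by
    rw [eq_top_iff, ← hS, Subgroup.closure_le]
    intro s hs
    rw [SetLike.mem_coe, ← hω s]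
    refine Subgroup.list_prod_mem _ fun x hx => ?_
    obtain ⟨i, hi, rfl⟩ := List.mem_map.1 hx
    exact Subgroup.subset_closure ⟨i, Set.mem_biUnion hs hi, rfl⟩
  refine Set.finite_univ_iff.1 (hI.subset fun j _ => ?_)
  by_contra hj
  have h1 := cs.geomRep_apply_eq_of_mem_closure hj (w := cs.simple j) (by rw [htop]; trivial)
    (root j)
  rw [geomRep_simple, geomReflection_root_self] at h1
  simp at h1
  linarith

lemma isIntegral_cosEntry (i j : B) : IsIntegral ℤ (M.cosEntry i j) := by
  have := Real.isIntegral_two_mul_cos_rat_mul_pi (1 / (M i j : ℚ))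
  rw [cosEntry]
  convert this using 3
  push_cast
  ring

include cs in
theorem exists_injective_integer_matrices [Finite B] :
    ∃ (k : ℕ) (ρ : W →* Matrix (Fin k) (Fin k) ℤ), Function.Injective ρ := by
  let R := Algebra.adjoin ℤ (Set.range fun p : B × B => M.cosEntry p.1 p.2)
  have hR : (Subalgebra.toSubmodule R).FG := fg_adjoin_of_finite (Set.finite_range _) (by
    rintro _ ⟨p, rfl⟩
    exact isIntegral_cosEntry p.1 p.2)
  -- The R-span of the simple roots. It is finitely generated and torsion-free over ℤ, hence free,
  -- and it contains a real basis, so the action on it is still faithful.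
  let L : Submodule ℤ (B →₀ ℝ) :=
    ⨆ i : B, (Subalgebra.toSubmodule R).map (Finsupp.lsingle i : ℝ →ₗ[ℤ] B →₀ ℝ)
  have hLfg : L.FG := Submodule.fg_iSup _ fun i => hR.map _
  have hsingle : ∀ i, ∀ x ∈ R, Finsupp.single i x ∈ L := fun i x hx =>
    Submodule.mem_iSup_of_mem i ⟨x, hx, rfl⟩
  have hinv : ∀ w, ∀ x ∈ L, ((cs.geomRep w).restrictScalars ℤ) x ∈ L := by
    intro w
    induction w using cs.simple_induction with
    | simple i =>
      rw [geomRep_simple]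
      change L ≤ L.comap _
      refine iSup_le fun j => Submodule.map_le_iff_le_comap.2 fun x hx => ?_
      change M.geomReflection i (Finsupp.single j x) ∈ L
      rw [geomReflection_apply, coroot_single, Finsupp.smul_single, smul_eq_mul, mul_one]
      exact add_mem (hsingle j x hx) (hsingle i _ (mul_mem hx
        (Algebra.subset_adjoin ⟨(i, j), rfl⟩)))
    | one => simp
    | mul w w' hw hw' =>
      intro x hx
      simpa using hw _ (hw' x hx)
  have : Module.Finite ℤ L := Module.Finite.iff_fg.2 hLfg
  have : Module.Free ℤ L := inferInstance
  let ρ : W →* Module.End ℤ L :=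
    { toFun := fun w => ((cs.geomRep w).restrictScalars ℤ).restrict (hinv w)
      map_one' := by ext x : 2; simp [LinearMap.restrict_apply]
      map_mul' := fun w w' => by ext x : 2; simp [LinearMap.restrict_apply] }
  refine ⟨_, (LinearMap.toMatrixAlgEquiv (Module.finBasis ℤ L)).toMulEquiv.toMonoidHom.comp ρ,
    (LinearMap.toMatrixAlgEquiv (Module.finBasis ℤ L)).injective.comp fun w w' h => ?_⟩
  refine cs.geomRep_injective (Finsupp.lhom_ext' fun i => LinearMap.ext_ring ?_)
  exact congrArg Subtype.val (LinearMap.congr_fun h ⟨root i, hsingle i 1 (one_mem R)⟩)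

end CoxeterSystem

theorem mainTheorem5 {B W : Type*} [Group W] (M : CoxeterMatrix B) (cs : CoxeterSystem M W)
    (hW : Group.FG W) : IsAccessible.{u, v} W := by
  have := cs.finite_of_fg hW
  obtain ⟨k, ρ, hρ⟩ := cs.exists_injective_integer_matrices
  exact isAccessible_of_injective hW hρ
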